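/- Let $M$ be a smooth manifold of dimension $n\ge 3$ with a Finsler structure $L:TM\to[0,\infty)$: $L$ is continuous, smooth and positive on the slit tangent bundle $\mathcal TM=TM\setminus 0$, positively homogeneous of degree one on the fibres, and the Finsler metric $g=\tfrac12\,\partial^2L^2/\partial y\,\partial y$ is positive definite. Let $\pi:\mathcal TM\to M$ be the projection, let $\pi$-vector fields be the sections of $\pi^{-1}(TM)$, let $\rho:T(\mathcal TM)\to\pi^{-1}(TM)$ be induced by $d\pi$, let $\gamma:\pi^{-1}(TM)\to T(\mathcal TM)$ be the vertical lift, and let $\overline\eta(u)=(u,u)$. Let $\nabla$ be the Cartan connection of $(M,L)$, i.e. the unique regular linear connection on $\pi^{-1}(TM)$ (the tangent spaces of $\mathcal TM$ are the direct sum of the vertical space $\ker d\pi$ and the horizontal space $\ker(X\mapsto\nabla_X\overline\eta)$) such that $\nabla g=0$, $\mathbf T(\beta\overline X,\beta\overline Y)=0$, and $T(\overline X,\overline Y):=\mathbf T(\gamma\overline X,\beta\overline Y)$ satisfies $g(T(\overline X,\overline Y),\overline Z)=g(T(\overline X,\overline Z),\overline Y)$; here $\mathbf T(X,Y)=\nabla_X\rho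 Y-\nabla_Y\rho X-\rho[X,Y]$ is the torsion and $\beta$ is the inverse of the restriction of $\rho$ to the horizontal bundle. Let $\mathbf K(X,Y)\overline Z=\nabla_X\nabla_Y\overline Z-\nabla_Y\nabla_X\overline Z-\nabla_{[X,Y]}\overline Z$ be the curvature of $\nabla$. Put $R(\overline X,\overline Y)\overline Z=\mathbf K(\beta\overline X,\beta\overline Y)\overline Z$ (the h-curvature tensor) and $\mathbf R(\overline X,\overline Y,\overline Z,\overline W)=g(R(\overline X,\overline Y)\overline Z,\overline W)$. Let $\mathrm{Ric}(\overline X,\overline Z)$ be the trace of $\overline Y\mapsto R(\overline X,\overline Y)\overline Z$, define $\mathrm{Ric}_o$ by $g(\mathrm{Ric}_o\overline X,\overline Y)=\mathrm{Ric}(\overline X,\overline Y)$, let $r$ be the trace of $\mathrm{Ric}_o$, and put $$(g\wedge\mathrm{Ric})(\overline X,\overline Y,\overline Z,\overline W)=g(\overline X,\overline Z)\mathrm{Ric}(\overline Y,\overline W)+g(\overline Y,\overline W)\mathrm{Ric}(\overline X,\overline Z)-g(\overline X,\overline W)\mathrm{Ric}(\overline Y,\overline Z)-g(\overline Y,\overline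 Z)\mathrm{Ric}(\overline X,\overline W).$$ Assume that $(M,L)$ is horizontally integrable, i.e. $R(\overline X,\overline Y)\overline\eta=0$ for all $\overline X,\overline Y$, and that it is hyper-generalized recurrent with recurrence forms $A,B$, i.e. $R$ is not identically zero and $A,B$ are smooth scalar 1-forms (sections of the dual of $\pi^{-1}(TM)$), neither identically zero, with $$(\nabla_{\beta\overline U}\mathbf R)(\overline X,\overline Y,\overline Z,\overline W)=A(\overline U)\,\mathbf R(\overline X,\overline Y,\overline Z,\overline W)+B(\overline U)\,(g\wedge\mathrm{Ric})(\overline X,\overline Y,\overline Z,\overline W).$$ Define $\overline\rho$ by $g(\overline\rho,\overline X)=B(\overline X)$. If $r=0$, then for all $\pi$-vector fields $\overline X,\overline Y,\overline Z,\overline W$: (a) $A\circ\mathrm{Ric}_o=0$ and $B\circ\mathrm{Ric}_o=0$; (b) $A(R(\overline X,\overline Y)\overline\rho)=0$; (c) $A(\overline X)B(R(\overline Y,\overline Z)\overline W)+A(\overline Y)B(R(\overline Z,\overline X)\overline W)+A(\overline Z)B(R(\overline X,\overline Y)\overline W)=0$. -/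

import Mathlib

open Bundle Manifold ContDiff

noncomputable section

namespace Finsler

/-! Throughout, `M` is a smooth manifold (without boundary) modelled on a finite-dimensional real
vector space `E`, and `TM` is its tangent bundle, itself a smooth manifold. -/

section Bundle

variable (E : Type*) [NormedAddCommGroup E] [NormedSpace ℝ E]
  (M : Type*) [TopologicalSpace M] [ChartedSpace E M] [IsManifold 𝓘(ℝ, E) ∞ M]

/-- The tangent bundle `TM`. -/
abbrev TM := TangentBundle 𝓘(ℝ, E) M

/-- The slit tangent bundle: the set of all nonzero tangent vectors, an open subset of `TM`. -/
def slit : Set (TM E M) := {u | u.snd ≠ 0}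

/-- The projection `π : TM → M`, as a smooth map. -/
def proj : C^∞⟮𝓘(ℝ, E).tangent, TM E M; 𝓘(ℝ, E), M⟯ :=
  ⟨fun u => u.proj, contMDiff_proj (TangentSpace 𝓘(ℝ, E))⟩

/-- The pullback bundle `π⁻¹(TM)`; its fibre at `u` is the tangent space of `M` at `π u`. -/
abbrev PiBundle : TM E M → Type _ :=
  (proj E M : TM E M → M) *ᵖ (TangentSpace 𝓘(ℝ, E) : M → Type _)

instance (u : TM E M) : AddCommGroup (PiBundle E M u) :=
  inferInstanceAs (AddCommGroup (TangentSpace 𝓘(ℝ, E) (proj E M u)))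

instance (u : TM E M) : IsTopologicalAddGroup (PiBundle E M u) :=
  inferInstanceAs (IsTopologicalAddGroup (TangentSpace 𝓘(ℝ, E) (proj E M u)))

instance (u : TM E M) : ContinuousSMul ℝ (PiBundle E M u) :=
  inferInstanceAs (ContinuousSMul ℝ (TangentSpace 𝓘(ℝ, E) (proj E M u)))

end Bundle

variable {E : Type*} [NormedAddCommGroup E] [NormedSpace ℝ E]
  {M : Type*} [TopologicalSpace M] [ChartedSpace E M] [IsManifold 𝓘(ℝ, E) ∞ M]

/-- `X` is a smooth section of the pullback bundle (a `π`-vector field) over `s`. -/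
def SmoothSection (s : Set (TM E M)) (X : ∀ u : TM E M, PiBundle E M u) : Prop :=
  ContMDiffOn 𝓘(ℝ, E).tangent (𝓘(ℝ, E).tangent.prod 𝓘(ℝ, E)) ∞
    (fun u => TotalSpace.mk' E u (X u)) s

/-- `X` is a smooth vector field on the manifold `TM` over `s`. -/
def SmoothField (s : Set (TM E M)) (X : ∀ u : TM E M, TangentSpace 𝓘(ℝ, E).tangent u) : Prop :=
  ContMDiffOn 𝓘(ℝ, E).tangent 𝓘(ℝ, E).tangent.tangent ∞
    (fun u => (⟨u, X u⟩ : TangentBundle 𝓘(ℝ, E).tangent (TM E M))) s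

/-- `f` is a smooth real function over `s`. -/
def SmoothFun (s : Set (TM E M)) (f : TM E M → ℝ) : Prop :=
  ContMDiffOn 𝓘(ℝ, E).tangent 𝓘(ℝ, ℝ) ∞ f s

/-- The fundamental `π`-vector field `η(u) = (u, u)`. -/
def eta (u : TM E M) : PiBundle E M u := u.snd

/-- The tangent vector of `M` at `x` given by an element of the model space `E` (the tangent space
of `M` at `x` is by definition a copy of `E`): the inclusion of a fibre into `TM`. -/
def fiberIncl (x : M) (y : E) : TM E M := ⟨x, y⟩

/-- The vector part of `u ∈ TM`, as an element of the model space. -/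
def vec (u : TM E M) : E := u.snd

/-- The bundle morphism `ρ : T(TM) → π⁻¹(TM)`, the differential of `π`. -/
def rho (u : TM E M) : TangentSpace 𝓘(ℝ, E).tangent u →L[ℝ] PiBundle E M u :=
  mfderiv 𝓘(ℝ, E).tangent 𝓘(ℝ, E) (proj E M) u

/-- The bundle morphism `γ : π⁻¹(TM) → T(TM)`, the vertical lift: the differential at `u` of the
inclusion of the fibre through `u`. -/
def gamma (u : TM E M) : PiBundle E M u →L[ℝ] TangentSpace 𝓘(ℝ, E).tangent u :=
  mfderiv 𝓘(ℝ, E) 𝓘(ℝ, E).tangent (fiberIncl u.proj) (vec u)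

/-! ### Finsler structures -/

/-- The Finsler metric `g = ½ ∂²L²/∂y∂y`: half the second derivative at `u` of the restriction
of `L²` to the fibre through `u`, a bilinear form on the fibre of `π⁻¹(TM)`. -/
def metric (L : TM E M → ℝ) (u : TM E M) :
    PiBundle E M u →L[ℝ] PiBundle E M u →L[ℝ] ℝ :=
  ((1 / 2 : ℝ) • fderiv ℝ (fderiv ℝ fun y : E => L (fiberIncl u.proj y) ^ 2) (vec u) :
    E →L[ℝ] E →L[ℝ] ℝ)

/-- `L` is a Finsler structure on `M`. -/
structure IsFinsler (L : TM E M → ℝ) : Prop where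
  continuous : Continuous L
  smooth : SmoothFun (slit E M) L
  pos : ∀ u ∈ slit E M, 0 < L u
  homogeneous : ∀ (x : M) (v : TangentSpace 𝓘(ℝ, E) x) (t : ℝ), 0 < t →
    L ⟨x, t • v⟩ = t * L ⟨x, v⟩
  metric_pos : ∀ u ∈ slit E M, ∀ v : PiBundle E M u, v ≠ 0 → 0 < metric L u v v

/-- The vector metrically equivalent to a linear form `a` on the fibre at `u`, i.e. the unique `v`
with `g(v, w) = a(w)` for all `w`. -/
def sharp (L : TM E M → ℝ) (u : TM E M) (a : PiBundle E M u → ℝ) : PiBundle E M u :=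
  Classical.epsilon fun v => ∀ w, metric L u v w = a w

/-! ### Linear connections on the pullback bundle -/

variable (E M) in
/-- A smooth linear connection on the pullback bundle over the slit tangent bundle.
Here `D σ u X` is the covariant derivative at `u` of the section `σ` in direction `X ∈ T_u(TM)`;
what `D` does outside the slit tangent bundle is irrelevant. -/
structure PiConnection where
  D : (∀ u : TM E M, PiBundle E M u) →
    (∀ u : TM E M, TangentSpace 𝓘(ℝ, E).tangent u →L[ℝ] PiBundle E M u)
  isCovariantDerivativeOn : IsCovariantDerivativeOn E D (slit E M)
  smooth : ∀ s : Set (TM E M), IsOpen s → s ⊆ slit E M → ∀ X σ,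
    SmoothField s X → SmoothSection s σ → SmoothSection s (fun u => D σ u (X u))

namespace PiConnection

variable (C : PiConnection E M)

/-- The connection map `K : X ↦ D_X η`. -/
def connMap (u : TM E M) : TangentSpace 𝓘(ℝ, E).tangent u →L[ℝ] PiBundle E M u :=
  C.D eta u

/-- The vertical space, the kernel of `dπ`. -/
def _root_.Finsler.vertical (u : TM E M) : Submodule ℝ (TangentSpace 𝓘(ℝ, E).tangent u) :=
  (rho u).ker

/-- The horizontal space, the kernel of the connection map. -/
def horizontal (u : TM E M) : Submodule ℝ (TangentSpace 𝓘(ℝ, E).tangent u) :=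
  (C.connMap u).ker

/-- The connection is regular. -/
def IsRegular : Prop := ∀ u ∈ slit E M, IsCompl (vertical u) (C.horizontal u)

/-- The horizontal map `β = (ρ|_H)⁻¹` of a regular connection: `β v` is the unique horizontal
vector that `ρ` maps to `v`. -/
def beta (u : TM E M) (v : PiBundle E M u) : TangentSpace 𝓘(ℝ, E).tangent u :=
  Classical.epsilon fun X => X ∈ C.horizontal u ∧ rho u X = v

/-- The horizontal lift of a `π`-vector field. -/
def hlift (X : ∀ u : TM E M, PiBundle E M u) (u : TM E M) : TangentSpace 𝓘(ℝ, E).tangent u :=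
  C.beta u (X u)

/-- The vertical lift of a `π`-vector field. -/
def _root_.Finsler.vlift (X : ∀ u : TM E M, PiBundle E M u) (u : TM E M) :
    TangentSpace 𝓘(ℝ, E).tangent u :=
  gamma u (X u)

/-- The classical torsion `𝐓(X, Y) = D_X ρY - D_Y ρX - ρ[X, Y]` for vector fields on `TM`. -/
def torsion (X Y : ∀ u : TM E M, TangentSpace 𝓘(ℝ, E).tangent u) (u : TM E M) :
    PiBundle E M u :=
  C.D (fun v => rho v (Y v)) u (X u) - C.D (fun v => rho v (X v)) u (Y u)
    - rho u (VectorField.mlieBracket 𝓘(ℝ, E).tangent X Y u)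

/-- The classical curvature `𝐊(X, Y)Z = D_X D_Y Z - D_Y D_X Z - D_[X, Y] Z`, for vector fields
`X`, `Y` on `TM` and a `π`-vector field `Z`. -/
def curvature (X Y : ∀ u : TM E M, TangentSpace 𝓘(ℝ, E).tangent u)
    (Z : ∀ u : TM E M, PiBundle E M u) (u : TM E M) : PiBundle E M u :=
  C.D (fun v => C.D Z v (Y v)) u (X u) - C.D (fun v => C.D Z v (X v)) u (Y u)
    - C.D Z u (VectorField.mlieBracket 𝓘(ℝ, E).tangent X Y u)

/-- `C` is the Cartan connection of `L`: regular, metric, with vanishing (h)h-torsion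
`Q(X, Y) = 𝐓(βX, βY)` and with (h)hv-torsion `T(X, Y) = 𝐓(γX, βY)` satisfying
`g(T(X, Y), Z) = g(T(X, Z), Y)`. Sections range over all local smooth ones. -/
structure IsCartan (L : TM E M → ℝ) : Prop where
  regular : C.IsRegular
  metric_compatible : ∀ s : Set (TM E M), IsOpen s → s ⊆ slit E M → ∀ Y Z,
    SmoothSection s Y → SmoothSection s Z →
    ∀ u ∈ s, ∀ X : TangentSpace 𝓘(ℝ, E).tangent u,
      mvfderiv 𝓘(ℝ, E).tangent (fun v => metric L v (Y v) (Z v)) u X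
        = metric L u (C.D Y u X) (Z u) + metric L u (Y u) (C.D Z u X)
  hh_torsion : ∀ s : Set (TM E M), IsOpen s → s ⊆ slit E M → ∀ X Y,
    SmoothSection s X → SmoothSection s Y →
    ∀ u ∈ s, C.torsion (C.hlift X) (C.hlift Y) u = 0
  hv_torsion : ∀ s : Set (TM E M), IsOpen s → s ⊆ slit E M → ∀ X Y Z,
    SmoothSection s X → SmoothSection s Y → SmoothSection s Z →
    ∀ u ∈ s, metric L u (C.torsion (vlift X) (C.hlift Y) u) (Z u)
      = metric L u (C.torsion (vlift X) (C.hlift Z) u) (Y u)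

/-! ### Horizontal curvature tensors -/

/-- The h-curvature tensor `R(X, Y)Z = 𝐊(βX, βY)Z` at `u`. It is a tensor, so it may be
evaluated on vectors by extending them to local smooth sections. -/
def R (u : TM E M) (x y z : PiBundle E M u) : PiBundle E M u :=
  C.curvature (C.hlift (FiberBundle.extend E x)) (C.hlift (FiberBundle.extend E y))
    (FiberBundle.extend E z) u

/-- The (v)h-torsion (contracted curvature) `R̂(X, Y) = R(X, Y)η`. -/
def Rhat (u : TM E M) (x y : PiBundle E M u) : PiBundle E M u := C.R u x y (eta u)

/-- Horizontal integrability: `R̂ = 0`. -/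
def HorizontallyIntegrable : Prop := ∀ u ∈ slit E M, ∀ x y, C.Rhat u x y = 0

/-- `𝐑(X, Y, Z, W) = g(R(X, Y)Z, W)`. -/
def R4 (L : TM E M → ℝ) (u : TM E M) (x y z w : PiBundle E M u) : ℝ :=
  metric L u (C.R u x y z) w

variable [FiniteDimensional ℝ E]

/-- The horizontal Ricci tensor `Ric(X, Z)`, the trace of `Y ↦ R(X, Y)Z` (equivalently, the
contraction of `𝐑(X, Y, Z, W)` in `Y` and `W`), computed in a basis of the fibre. -/
def Ric (u : TM E M) (x z : PiBundle E M u) : ℝ :=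
  ∑ i, (Module.finBasis ℝ E).coord i (C.R u x (Module.finBasis ℝ E i) z)

/-- The horizontal Ricci vector form: `g(Ric_o X, Y) = Ric(X, Y)`. -/
def Rico (L : TM E M → ℝ) (u : TM E M) (x : PiBundle E M u) : PiBundle E M u :=
  sharp L u (C.Ric u x)

/-- The horizontal scalar curvature, the trace of `Ric_o`. -/
def scalar (L : TM E M → ℝ) (u : TM E M) : ℝ :=
  ∑ i, (Module.finBasis ℝ E).coord i (C.Rico L u (Module.finBasis ℝ E i))

/-- The Kulkarni–Nomizu product `g ∧ Ric`. -/
def gKNRic (L : TM E M → ℝ) (u : TM E M) (x y z w : PiBundle E M u) : ℝ :=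
  metric L u x z * C.Ric u y w + metric L u y w * C.Ric u x z
    - metric L u x w * C.Ric u y z - metric L u y z * C.Ric u x w

/-- The h-covariant derivative of a covariant `π`-tensor field `T` of order four,
`(∇T)(U, X, Y, Z, W) = (∇_{βU} T)(X, Y, Z, W)`, for `π`-vector fields `U, X, Y, Z, W`. -/
def hDeriv (T : ∀ u : TM E M, PiBundle E M u → PiBundle E M u → PiBundle E M u →
      PiBundle E M u → ℝ)
    (U X Y Z W : ∀ u : TM E M, PiBundle E M u) (u : TM E M) : ℝ :=
  mvfderiv 𝓘(ℝ, E).tangent (fun v => T v (X v) (Y v) (Z v) (W v)) u (C.hlift U u)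
    - T u (C.D X u (C.hlift U u)) (Y u) (Z u) (W u)
    - T u (X u) (C.D Y u (C.hlift U u)) (Z u) (W u)
    - T u (X u) (Y u) (C.D Z u (C.hlift U u)) (W u)
    - T u (X u) (Y u) (Z u) (C.D W u (C.hlift U u))

end PiConnection

/-- A smooth scalar 1-form: a smooth section, over the slit tangent bundle, of the dual of the
pullback bundle. -/
def SmoothForm (A : ∀ u : TM E M, PiBundle E M u →L[ℝ] ℝ) : Prop :=
  ∀ s : Set (TM E M), IsOpen s → s ⊆ slit E M → ∀ X, SmoothSection s X →
    SmoothFun s (fun u => A u (X u))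

/-- `(M, L)`, with Cartan connection `C`, is hyper-generalized recurrent with recurrence forms
`A` and `B`: the h-curvature tensor and both forms are not identically zero, and
`∇𝐑 = A ⊗ 𝐑 + B ⊗ (g ∧ Ric)` for the h-covariant derivative. -/
structure IsHyperGeneralizedRecurrent [FiniteDimensional ℝ E] (L : TM E M → ℝ) (C : PiConnection E M)
    (A B : ∀ u : TM E M, PiBundle E M u →L[ℝ] ℝ) : Prop where
  R_ne_zero : ∃ u ∈ slit E M, ∃ x y z, C.R u x y z ≠ 0
  A_smooth : SmoothForm A
  B_smooth : SmoothForm B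
  A_ne_zero : ∃ u ∈ slit E M, A u ≠ 0
  B_ne_zero : ∃ u ∈ slit E M, B u ≠ 0
  recurrent : ∀ s : Set (TM E M), IsOpen s → s ⊆ slit E M → ∀ U X Y Z W,
    SmoothSection s U → SmoothSection s X → SmoothSection s Y → SmoothSection s Z →
    SmoothSection s W → ∀ u ∈ s,
      C.hDeriv (C.R4 L) U X Y Z W u
        = A u (U u) * C.R4 L u (X u) (Y u) (Z u) (W u)
          + B u (U u) * C.gKNRic L u (X u) (Y u) (Z u) (W u)

end Finsler

end

/-! The whole conclusion is pointwise algebra once two differential facts are known.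

Horizontal integrability says exactly that brackets of horizontal fields are horizontal: `R(X,Y)η =
-D_[βX,βY] η`, because `η` is parallel along horizontal directions
(`HorizontallyIntegrable.hlift_hbracket`). The correction terms in the Bianchi identities then
vanish, so `R` has the symmetries of a Riemannian curvature tensor (`IsCartan.R4_swap_right`,
`IsCartan.bianchi_first`) and its h-derivative has vanishing cyclic sum
(`IsCartan.hDeriv_R4_cyclic`). Moreover `∇𝐑` vanishes as soon as `η` is in the third slot
(`IsCartan.hDeriv_R4_eta`).

Pair symmetry turns `R(·,·)η = 0` into `R(η,·) = 0`, hence `Ric(η,·) = Ric(·,η) = 0`. The recurrence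
relation with `η` in the first and third slots reduces to `g(η,η) B ⊗ Ric = 0`, and so `B ⊗ Ric =
0`. The `B` term therefore drops out of the recurrence, and the cyclic sum becomes `A(t) R(x,y) +
A(x) R(y,t) + A(y) R(t,x) = 0`. Pairing this with `ρ` is (c). One contraction gives `A(t) Ric(x,z) -
A(x) Ric(t,z) + A(R(t,x)z) = 0`, and `z = ρ` is (b). A second contraction gives `r A(t) = 2 A(Ric_o
t)`, so `r = 0` gives the first half of (a); the second half is `Ric(x,ρ) = 0`. This algebra is
`recurrence_form_relations`.

The analytic work is to show that metric, horizontal lifts and curvature are smooth, and that `R`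
may be computed with any local extensions of its arguments (`R_eq`). It is phrased with germs at a
point, so that no domains have to be carried along. -/

noncomputable section

open Filter Topology VectorField

/-! ### Germs of smooth functions and sections -/

namespace SmoothGerm

variable {EB : Type*} [NormedAddCommGroup EB] [NormedSpace ℝ EB]
  {H : Type*} [TopologicalSpace H] {I : ModelWithCorners ℝ EB H}
  {B : Type*} [TopologicalSpace B] [ChartedSpace H B]
  {F : Type*} [NormedAddCommGroup F] [NormedSpace ℝ F]
  {V : B → Type*} [TopologicalSpace (TotalSpace F V)]
  [∀ x, AddCommGroup (V x)] [∀ x, Module ℝ (V x)] [∀ x, TopologicalSpace (V x)]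
  [FiberBundle F V]

variable (I) in
/-- `f` is smooth on a neighbourhood of `x`. -/
def Fn (f : B → ℝ) (x : B) : Prop := ∀ᶠ y in 𝓝 x, ContMDiffAt I 𝓘(ℝ, ℝ) ∞ f y

variable (I F) in
/-- The section `σ` is smooth on a neighbourhood of `x`. -/
def Sec (σ : ∀ x, V x) (x : B) : Prop :=
  ∀ᶠ y in 𝓝 x, ContMDiffAt I (I.prod 𝓘(ℝ, F)) ∞ (fun z => TotalSpace.mk' F z (σ z)) y

variable {f g : B → ℝ} {σ τ : ∀ x, V x} {x : B}

theorem Fn.contMDiffAt (h : Fn I f x) : ContMDiffAt I 𝓘(ℝ, ℝ) ∞ f x := h.self_of_nhds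

theorem Sec.contMDiffAt (h : Sec I F σ x) :
    ContMDiffAt I (I.prod 𝓘(ℝ, F)) ∞ (fun z => TotalSpace.mk' F z (σ z)) x := h.self_of_nhds

theorem Fn.mdifferentiableAt (h : Fn I f x) : MDifferentiableAt I 𝓘(ℝ, ℝ) f x :=
  h.contMDiffAt.mdifferentiableAt (by simp)

theorem Sec.mdifferentiableAt (h : Sec I F σ x) :
    MDifferentiableAt I (I.prod 𝓘(ℝ, F)) (fun z => TotalSpace.mk' F z (σ z)) x :=
  h.contMDiffAt.mdifferentiableAt (by simp)

theorem Fn.eventually (h : Fn I f x) : ∀ᶠ y in 𝓝 x, Fn I f y := eventually_eventually_nhds.2 h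

theorem Sec.eventually (h : Sec I F σ x) : ∀ᶠ y in 𝓝 x, Sec I F σ y :=
  eventually_eventually_nhds.2 h

theorem Fn.congr (h : Fn I f x) (e : g =ᶠ[𝓝 x] f) : Fn I g x := by
  filter_upwards [h, e.eventuallyEq_nhds] with y hy ey using hy.congr_of_eventuallyEq ey

theorem Sec.congr (h : Sec I F σ x) (e : ∀ᶠ y in 𝓝 x, τ y = σ y) : Sec I F τ x := by
  filter_upwards [h, eventually_eventually_nhds.2 e] with y hy ey
  exact hy.congr_of_eventuallyEq (ey.mono fun z hz => by simp only [hz])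

theorem mvfderiv_congr (e : g =ᶠ[𝓝 x] f) (w : TangentSpace I x) :
    mvfderiv I g x w = mvfderiv I f x w := by
  change mfderiv I 𝓘(ℝ, ℝ) g x w = mfderiv I 𝓘(ℝ, ℝ) f x w
  rw [e.mfderiv_eq]
  rfl

theorem Fn.const (c : ℝ) (x : B) : Fn I (fun _ => c) x :=
  Eventually.of_forall fun _ => contMDiffAt_const

section
variable [VectorBundle ℝ F V]

theorem Sec.add (hσ : Sec I F σ x) (hτ : Sec I F τ x) : Sec I F (σ + τ) x := by
  filter_upwards [hσ, hτ] with y h h' using h.add_section h'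

theorem Sec.sub (hσ : Sec I F σ x) (hτ : Sec I F τ x) : Sec I F (σ - τ) x := by
  filter_upwards [hσ, hτ] with y h h' using h.sub_section h'

theorem Sec.smul (hf : Fn I f x) (hσ : Sec I F σ x) : Sec I F (f • σ) x := by
  filter_upwards [hf, hσ] with y h h' using h.smul_section h'

variable [ContMDiffVectorBundle ∞ F V I]

theorem Sec.extend (v : V x) : Sec I F (FiberBundle.extend F v) x := by
  obtain ⟨s, hs, h⟩ := FiberBundle.exists_contMDiffOn_extend (k := ∞) I F v
  filter_upwards [eventually_mem_nhds_iff.2 hs] with y hy using h.contMDiffAt hy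

variable [FiniteDimensional ℝ F]

/-- An additive, function-linear operation on germs of smooth sections depends only on the value
of the section at the base point. -/
theorem eq_of_tensorial {A : Type*} [AddCommGroup A] [Module ℝ A] {Φ : (∀ x, V x) → A}
    (hadd : ∀ σ τ, Sec I F σ x → Sec I F τ x → Φ (σ + τ) = Φ σ + Φ τ)
    (hsmul : ∀ f σ, Fn I f x → Sec I F σ x → Φ (f • σ) = f x • Φ σ)
    (hσ : Sec I F σ x) (hτ : Sec I F τ x) (h : σ x = τ x) : Φ σ = Φ τ := by
  classical
  have : ContMDiffVectorBundle 1 F V I := ContMDiffVectorBundle.of_le (by simp : (1 : ℕ∞ω) ≤ ∞)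
  have hloc : ∀ {σ τ : ∀ x, V x}, Sec I F σ x → Sec I F τ x →
      (∀ᶠ y in 𝓝 x, σ y = τ y) → Φ σ = Φ τ := by
    intro σ τ hσ hτ e
    -- The indicator of the set of agreement is the constant 1 near `x`, so it is a smooth germ
    -- there, and multiplying by it makes the sections equal everywhere. No bump function is needed.
    let ψ : B → ℝ := fun y => if σ y = τ y then 1 else 0
    have hψ : Fn I ψ x := (Fn.const 1 x).congr (e.mono fun y hy => by simp [ψ, hy])
    have hψx : ψ x = 1 := by simp [ψ, e.self_of_nhds]
    have hmul : ψ • σ = ψ • τ := by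
      funext y
      by_cases hy : σ y = τ y <;> simp [ψ, hy]
    calc Φ σ = Φ (ψ • σ) := by rw [hsmul _ _ hψ hσ, hψx, one_smul]
      _ = Φ (ψ • τ) := by rw [hmul]
      _ = Φ τ := by rw [hsmul _ _ hψ hτ, hψx, one_smul]
  let t := trivializationAt F V x
  have xm : x ∈ t.baseSet := FiberBundle.mem_baseSet_trivializationAt F V x
  have hU : ∀ᶠ y in 𝓝 x, y ∈ t.baseSet := t.open_baseSet.mem_nhds xm
  let b := Module.finBasis ℝ F
  let s := t.localFrame b
  let c := t.localFrameCoeff I b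
  have hs (i) : Sec I F (s i) x := by
    filter_upwards [hU] with y hy using contMDiffAt_localFrame_of_mem ∞ t b i hy
  have hc {σ : ∀ x, V x} (hσ : Sec I F σ x) (i) : Fn I (fun y => c i y (σ y)) x := by
    filter_upwards [hU, hσ] with y hy hy' using contMDiffAt_localFrameCoeff b hy hy' i
  have hexp {σ : ∀ x, V x} (hσ : Sec I F σ x) : Φ σ = ∑ i, c i x (σ x) • Φ (s i) := by
    have hsum : ∀ S : Finset (Fin (Module.finrank ℝ F)),
        Sec I F (∑ i ∈ S, (fun y => c i y (σ y)) • s i) x ∧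
          Φ (∑ i ∈ S, (fun y => c i y (σ y)) • s i) = ∑ i ∈ S, c i x (σ x) • Φ (s i) := by
      intro S
      induction S using Finset.induction_on with
      | empty =>
        have h0 : Sec I F (0 : ∀ x, V x) x := by
          simpa using (Sec.smul (Fn.const 0 x) hσ).congr (τ := 0)
            (Eventually.of_forall fun y => by simp)
        refine ⟨by simpa using h0, ?_⟩
        have := hsmul 0 0 (Fn.const 0 x) h0
        simpa using this
      | insert a S ha ih =>
        rw [Finset.sum_insert ha, Finset.sum_insert ha]
        refine ⟨((hs a).smul (hc hσ a)).add ih.1, ?_⟩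
        rw [hadd _ _ ((hs a).smul (hc hσ a)) ih.1, ih.2, hsmul _ _ (hc hσ a) (hs a)]
    obtain ⟨h1, h2⟩ := hsum Finset.univ
    rw [← h2]
    refine hloc hσ h1 ?_
    filter_upwards [t.eventually_eq_localFrame_sum_coeff_smul (I := I) (s := σ) b xm] with y hy
    rw [hy]
    simp [c, s, Finset.sum_apply, ← hy]
  rw [hexp hσ, hexp hτ, h]

end

/-! ### Germs of smooth vector fields -/

theorem natCast_le_infty (n : ℕ) : (n : ℕ∞ω) ≤ ∞ := by
  have : ((n : ℕ∞) : ℕ∞ω) ≤ ∞ := WithTop.coe_le_coe.2 le_top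
  simpa using this

section Fields

variable [IsManifold I ∞ B] {X Y Z : ∀ x : B, TangentSpace I x}

theorem isManifold_of_le_infty {n : ℕ∞ω} (hn : n ≤ ∞) : IsManifold I n B := .of_le hn

variable [FiniteDimensional ℝ EB]

theorem bracket (hX : Sec I EB X x) (hY : Sec I EB Y x) :
    Sec I EB (mlieBracket I X Y) x := by
  have : CompleteSpace EB := FiniteDimensional.complete ℝ EB
  have : IsManifold I (minSmoothness ℝ 2) B := by simp; infer_instance
  have : IsManifold I (((⊤ : ℕ∞) : ℕ∞ω) + 1) B := isManifold_of_le_infty (by simp)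
  filter_upwards [hX, hY] with y h h'
  exact ContMDiffAt.mlieBracket_vectorField (n := ⊤) (m := ⊤) h h' (by simp)

theorem jacobi (hX : Sec I EB X x) (hY : Sec I EB Y x) (hZ : Sec I EB Z x) :
    mlieBracket I X (mlieBracket I Y Z) x =
      mlieBracket I (mlieBracket I X Y) Z x + mlieBracket I Y (mlieBracket I X Z) x := by
  have : CompleteSpace EB := FiniteDimensional.complete ℝ EB
  have : IsManifold I (minSmoothness ℝ 3) B :=
    isManifold_of_le_infty (by simpa using natCast_le_infty 3)
  have h2 : minSmoothness ℝ 2 ≤ ∞ := by simpa using natCast_le_infty 2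
  exact leibniz_identity_mlieBracket_apply (hX.contMDiffAt.of_le h2) (hY.contMDiffAt.of_le h2)
    (hZ.contMDiffAt.of_le h2)

theorem jacobi_cyclic (hX : Sec I EB X x) (hY : Sec I EB Y x) (hZ : Sec I EB Z x) :
    mlieBracket I X (mlieBracket I Y Z) x + mlieBracket I Y (mlieBracket I Z X) x
      + mlieBracket I Z (mlieBracket I X Y) x = 0 := by
  have : CompleteSpace EB := FiniteDimensional.complete ℝ EB
  have : IsManifold I 2 B := isManifold_of_le_infty (natCast_le_infty 2)
  have e : mlieBracket I Z X = (-1 : ℝ) • mlieBracket I X Z := by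
    rw [mlieBracket_swap, neg_one_smul]
  rw [jacobi hX hY hZ, e, mlieBracket_const_smul_right (bracket hX hZ).mdifferentiableAt,
    mlieBracket_swap_apply (V := Z)]
  module

variable [Nontrivial EB]

omit [FiniteDimensional ℝ EB] in
-- Since the field has constant coordinate `w` near `x`, a fixed functional reads off the
-- coefficient `h` from `h • U`.
theorem exists_sec_eventually_triv_eq (x : B) {w : EB} :
    ∃ U : ∀ y : B, TangentSpace I y, Sec I EB U x ∧
      ∀ᶠ y in 𝓝 x, (trivializationAt EB (TangentSpace I) x ⟨y, U y⟩).2 = w := by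
  let e := trivializationAt EB (TangentSpace I : B → Type _) x
  have hx : x ∈ e.baseSet := FiberBundle.mem_baseSet_trivializationAt EB _ x
  refine ⟨FiberBundle.extend EB (e.symm x w), Sec.extend _, ?_⟩
  filter_upwards [e.open_baseSet.mem_nhds hx] with y hy
  simp only [FiberBundle.extend]
  change (e ⟨y, e.symm y (e ⟨x, e.symm x w⟩).2⟩).2 = w
  rw [e.apply_mk_symm hx, e.apply_mk_symm hy]

/-- The derivative of a smooth function along a smooth vector field is smooth. -/
theorem Fn.deriv (hf : Fn I f x) (hX : Sec I EB X x) :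
    Fn I (fun y => mvfderiv I f y (X y)) x := by
  have : CompleteSpace EB := FiniteDimensional.complete ℝ EB
  have : IsManifold I 2 B := isManifold_of_le_infty (natCast_le_infty 2)
  have : IsManifold I 1 B := isManifold_of_le_infty (by simp)
  filter_upwards [hf.eventually, hX.eventually] with x hf hX
  obtain ⟨w, hw⟩ := exists_ne (0 : EB)
  obtain ⟨φ, hφ⟩ := SeparatingDual.exists_eq_one (R := ℝ) hw
  obtain ⟨U, hU, hUw⟩ := exists_sec_eventually_triv_eq (I := I) (w := w) x
  -- The Leibniz rule writes `(Xf) U` as `[X, fU] - f [X, U]`, which is smooth because brackets are;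
  -- `φ` then extracts `Xf`.
  have h1 : Sec I EB ((fun y => mvfderiv I f y (X y)) • U) x := by
    refine ((bracket hX (hU.smul hf)).sub ((bracket hX hU).smul hf)).congr ?_
    filter_upwards [hf.eventually, hU.eventually] with y hfy hUy
    simp [mlieBracket_smul_right hfy.mdifferentiableAt hUy.mdifferentiableAt]
  have h2 := φ.contMDiff.contMDiffAt.comp x ((contMDiffAt_section x).1 h1.contMDiffAt)
  refine h2.congr_of_eventuallyEq ?_
  have hx : x ∈ (trivializationAt EB (TangentSpace I : B → Type _) x).baseSet :=
    FiberBundle.mem_baseSet_trivializationAt EB _ x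
  filter_upwards [hUw, (trivializationAt EB (TangentSpace I) x).open_baseSet.mem_nhds hx] with y hy hy'
  have := (trivializationAt EB (TangentSpace I : B → Type _) x).linear ℝ hy'
  simp [this.map_smul, hy, hφ]

/-- The Lie bracket acts on functions as the commutator of derivations. -/
theorem mvfderiv_mlieBracket (hf : Fn I f x) (hX : Sec I EB X x) (hY : Sec I EB Y x) :
    mvfderiv I f x (mlieBracket I X Y x) =
      mvfderiv I (fun y => mvfderiv I f y (Y y)) x (X x)
        - mvfderiv I (fun y => mvfderiv I f y (X y)) x (Y x) := by
  have : CompleteSpace EB := FiniteDimensional.complete ℝ EB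
  have : IsManifold I 2 B := isManifold_of_le_infty (natCast_le_infty 2)
  have : IsManifold I 1 B := isManifold_of_le_infty (by simp)
  obtain ⟨w, hw⟩ := exists_ne (0 : EB)
  obtain ⟨U, hU, hUx⟩ : ∃ U : ∀ y : B, TangentSpace I y, Sec I EB U x ∧ U x ≠ 0 := by
    let w' : TangentSpace I x := w
    have hw' : w' ≠ 0 := hw
    exact ⟨FiberBundle.extend EB w', Sec.extend _, by simpa using hw'⟩
  have key : ∀ {X : ∀ y : B, TangentSpace I y}, Sec I EB X x → ∀ᶠ y in 𝓝 x,
      mlieBracket I X (f • U) y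
        = ((fun y => mvfderiv I f y (X y)) • U + f • mlieBracket I X U) y := by
    intro X hX
    filter_upwards [hf.eventually, hU.eventually] with y hfy hUy
    simp [mlieBracket_smul_right hfy.mdifferentiableAt hUy.mdifferentiableAt]
  have key2 : ∀ {X Y : ∀ y : B, TangentSpace I y}, Sec I EB X x → Sec I EB Y x →
      mlieBracket I X (mlieBracket I Y (f • U)) x
        = mvfderiv I (fun y => mvfderiv I f y (Y y)) x (X x) • U x
          + mvfderiv I f x (Y x) • mlieBracket I X U x
          + (mvfderiv I f x (X x) • mlieBracket I Y U x
            + f x • mlieBracket I X (mlieBracket I Y U) x) := by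
    intro X Y hX hY
    rw [EventuallyEq.mlieBracket_vectorField_eq (EventuallyEq.refl _ X) (key hY),
      mlieBracket_add_right (hU.smul (hf.deriv hY)).mdifferentiableAt
        ((bracket hY hU).smul hf).mdifferentiableAt,
      mlieBracket_smul_right (hf.deriv hY).mdifferentiableAt hU.mdifferentiableAt,
      mlieBracket_smul_right hf.mdifferentiableAt (bracket hY hU).mdifferentiableAt]
  -- The Jacobi identity for `X, Y, fU` minus `f` times that for `X, Y, U` leaves the claimed
  -- identity multiplied by `U x ≠ 0`.
  have hj := jacobi hX hY (hU.smul hf)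
  rw [key2 hX hY, key2 hY hX, mlieBracket_smul_right hf.mdifferentiableAt hU.mdifferentiableAt,
    jacobi hX hY hU] at hj
  have : (mvfderiv I f x (mlieBracket I X Y x)
      - (mvfderiv I (fun y => mvfderiv I f y (Y y)) x (X x)
        - mvfderiv I (fun y => mvfderiv I f y (X y)) x (Y x))) • U x = 0 := by
    rw [sub_smul, sub_smul]
    linear_combination (norm := module) -hj
  exact sub_eq_zero.1 ((smul_eq_zero.1 this).resolve_right hUx)

end Fields
end SmoothGerm

open SmoothGerm

namespace Finsler

variable {E : Type*} [NormedAddCommGroup E] [NormedSpace ℝ E]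
  {M : Type*} [TopologicalSpace M] [ChartedSpace E M] [IsManifold 𝓘(ℝ, E) ∞ M]
  {u : TM E M}

/-! ### Smooth germs on the tangent bundle -/

variable (E M) in
-- Trivializations are linear on fibres, so a vector vanishes exactly when its continuous fibre
-- coordinate does.
theorem isOpen_slit : IsOpen (slit E M) := by
  rw [isOpen_iff_mem_nhds]
  intro u hu
  let e := trivializationAt E (TangentSpace 𝓘(ℝ, E) : M → Type _) u.proj
  have hue : u.proj ∈ e.baseSet := FiberBundle.mem_baseSet_trivializationAt E _ u.proj
  have hus : u ∈ e.source := e.mem_source.2 hue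
  have key : ∀ v : TM E M, v.proj ∈ e.baseSet → ((e v).2 = 0 ↔ v.snd = 0) := by
    intro v hv
    have h : (e v).2 = e.continuousLinearEquivAt ℝ v.proj hv v.snd := by
      simp [e.continuousLinearEquivAt_apply ℝ]
    rw [h, ContinuousLinearEquiv.map_eq_zero_iff]
  have h1 : ContinuousAt (fun v => (e v).2) u :=
    continuousAt_snd.comp (e.continuousAt hus)
  have h2 : (e u).2 ≠ 0 := fun h => hu ((key u hue).1 h)
  filter_upwards [h1.eventually_ne h2, e.open_source.mem_nhds hus] with v hv hv'
  exact fun h => hv ((key v (e.mem_source.1 hv')).2 h)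

theorem eventually_slit (hu : u ∈ slit E M) : ∀ᶠ v in 𝓝 u, v ∈ slit E M :=
  (isOpen_slit E M).mem_nhds hu

/-- A `π`-vector field is smooth near `u`. -/
abbrev PiGerm (σ : ∀ u : TM E M, PiBundle E M u) (u : TM E M) : Prop :=
  Sec 𝓘(ℝ, E).tangent E σ u

/-- A vector field on `TM` is smooth near `u`. -/
abbrev FieldGerm (X : ∀ u : TM E M, TangentSpace 𝓘(ℝ, E).tangent u) (u : TM E M) : Prop :=
  Sec 𝓘(ℝ, E).tangent (E × E) X u

/-- A function on `TM` is smooth near `u`. -/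
abbrev FnGerm (f : TM E M → ℝ) (u : TM E M) : Prop := Fn 𝓘(ℝ, E).tangent f u

theorem SmoothSection.germ {s : Set (TM E M)} (hs : IsOpen s) {σ} (h : SmoothSection s σ)
    (hu : u ∈ s) : PiGerm σ u := by
  filter_upwards [hs.mem_nhds hu] with v hv using h.contMDiffAt (hs.mem_nhds hv)

theorem eventually_nhds_iff_exists_isOpen {P : TM E M → Prop} : (∀ᶠ v in 𝓝 u, P v) ↔
    ∃ s : Set (TM E M), IsOpen s ∧ u ∈ s ∧ ∀ v ∈ s, P v := by
  rw [eventually_nhds_iff]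
  exact ⟨fun ⟨s, h1, h2, h3⟩ => ⟨s, h2, h3, h1⟩, fun ⟨s, h1, h2, h3⟩ => ⟨s, h3, h1, h2⟩⟩

/-- A section of the pullback bundle amounts to a map `TM → TM` covering `π`. In this form `η` is
the identity, and `ρ ∘ X` is the tangent map of `π` composed with `X`. -/
theorem piGerm_iff {σ : ∀ u : TM E M, PiBundle E M u} :
    PiGerm σ u ↔ ∀ᶠ v in 𝓝 u,
      ContMDiffAt 𝓘(ℝ, E).tangent 𝓘(ℝ, E).tangent ∞ (fun w => (⟨w.proj, σ w⟩ : TM E M)) v := by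
  refine eventually_congr (Eventually.of_forall fun v => ?_)
  rw [contMDiffAt_section, contMDiffAt_totalSpace]
  exact ⟨fun h => ⟨(proj E M).contMDiff.contMDiffAt, h⟩, fun h => h.2⟩

theorem piGerm_eta (u : TM E M) : PiGerm (eta : ∀ u : TM E M, PiBundle E M u) u :=
  piGerm_iff.2 (Eventually.of_forall fun _ => contMDiffAt_id)

theorem piGerm_rho {X : ∀ u : TM E M, TangentSpace 𝓘(ℝ, E).tangent u} (hX : FieldGerm X u) :
    PiGerm (fun v => rho v (X v)) u := by
  refine piGerm_iff.2 (hX.mono fun v hv => ?_)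
  have h : ContMDiff 𝓘(ℝ, E).tangent.tangent 𝓘(ℝ, E).tangent ∞
      (tangentMap 𝓘(ℝ, E).tangent 𝓘(ℝ, E) (proj E M)) :=
    (proj E M).contMDiff.contMDiff_tangentMap (by simp)
  exact h.contMDiffAt.comp v hv

namespace PiConnection

variable (C : PiConnection E M) {σ τ : ∀ u : TM E M, PiBundle E M u}
  {X Y : ∀ u : TM E M, TangentSpace 𝓘(ℝ, E).tangent u} {f : TM E M → ℝ}

theorem piGerm_D (hu : u ∈ slit E M) (hX : FieldGerm X u) (hσ : PiGerm σ u) :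
    PiGerm (fun v => C.D σ v (X v)) u := by
  obtain ⟨s, hs, hus, h⟩ := eventually_nhds_iff_exists_isOpen.1 ((hX.and hσ).and (eventually_slit hu))
  exact (C.smooth s hs (fun v hv => (h v hv).2) X σ
    (fun v hv => (h v hv).1.1.contMDiffWithinAt)
    (fun v hv => (h v hv).1.2.contMDiffWithinAt)).germ hs hus

theorem D_add (hu : u ∈ slit E M) (hσ : PiGerm σ u) (hτ : PiGerm τ u) :
    C.D (σ + τ) u = C.D σ u + C.D τ u :=
  C.isCovariantDerivativeOn.add hσ.mdifferentiableAt hτ.mdifferentiableAt hu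

theorem D_smul (hu : u ∈ slit E M) (hf : FnGerm f u) (hσ : PiGerm σ u)
    (x : TangentSpace 𝓘(ℝ, E).tangent u) :
    C.D (f • σ) u x = f u • C.D σ u x + mvfderiv 𝓘(ℝ, E).tangent f u x • σ u := by
  rw [C.isCovariantDerivativeOn.leibniz hσ.mdifferentiableAt hf.mdifferentiableAt hu]
  simp

theorem D_sub (hu : u ∈ slit E M) (hσ : PiGerm σ u) (hτ : PiGerm τ u) :
    C.D (σ - τ) u = C.D σ u - C.D τ u := by
  have h := C.D_add hu (hσ.sub hτ) hτ
  rw [sub_add_cancel] at h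
  rw [h, add_sub_cancel_right]

theorem D_congr (hu : u ∈ slit E M) (hτ : PiGerm τ u) (h : ∀ᶠ v in 𝓝 u, σ v = τ v) :
    C.D σ u = C.D τ u :=
  C.isCovariantDerivativeOn.congr_of_eventuallyEq (hτ.congr h).mdifferentiableAt
    hτ.mdifferentiableAt ((isOpen_slit E M).mem_nhds hu) h

end PiConnection
end Finsler

/-- A family of continuous linear maps on a finite-dimensional space is smooth if it is smooth on
each vector. -/
theorem contMDiffAt_clm_of_apply {EB : Type*} [NormedAddCommGroup EB] [NormedSpace ℝ EB]
    {H : Type*} [TopologicalSpace H] {I : ModelWithCorners ℝ EB H}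
    {B : Type*} [TopologicalSpace B] [ChartedSpace H B]
    {F G : Type*} [NormedAddCommGroup F] [NormedSpace ℝ F] [FiniteDimensional ℝ F]
    [NormedAddCommGroup G] [NormedSpace ℝ G] {n : ℕ∞ω} {A : B → F →L[ℝ] G} {x : B}
    (h : ∀ w, ContMDiffAt I 𝓘(ℝ, G) n (fun y => A y w) x) :
    ContMDiffAt I 𝓘(ℝ, F →L[ℝ] G) n A x := by
  let b := Module.finBasis ℝ F
  have hA : A = fun y => ∑ i, ContinuousLinearMap.smulRightL ℝ F G
      (LinearMap.toContinuousLinearMap (b.coord i)) (A y (b i)) := by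
    funext y
    ext w
    conv_lhs => rw [← b.sum_repr w]
    simp only [map_sum, map_smul]
    simp
  rw [hA]
  exact ContMDiffAt.sum fun i _ => (ContinuousLinearMap.contMDiff _).contMDiffAt.comp x (h (b i))

/-! ### Horizontal lifts of a regular connection -/

namespace Finsler

variable {E : Type*} [NormedAddCommGroup E] [NormedSpace ℝ E]
  {M : Type*} [TopologicalSpace M] [ChartedSpace E M] [IsManifold 𝓘(ℝ, E) ∞ M]
  {u : TM E M}

namespace PiConnection

variable (C : PiConnection E M) {σ τ : ∀ u : TM E M, PiBundle E M u}
  {X Y : ∀ u : TM E M, TangentSpace 𝓘(ℝ, E).tangent u} {f : TM E M → ℝ}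

variable {C} in
theorem IsRegular.eq_zero (h : C.IsRegular) (hu : u ∈ slit E M)
    {x : TangentSpace 𝓘(ℝ, E).tangent u} (h1 : rho u x = 0) (h2 : C.D eta u x = 0) : x = 0 :=
  (Submodule.disjoint_def.1 (h u hu).disjoint) x h1 h2

variable [FiniteDimensional ℝ E]

variable {C} in
-- Regularity makes `(ρ, D η)` injective on a space of dimension `2n` with values in one of the same
-- dimension, hence surjective; a preimage of `(v, 0)` is horizontal over `v`.
theorem IsRegular.exists_horizontal (h : C.IsRegular) (hu : u ∈ slit E M)
    (v : PiBundle E M u) : ∃ x, x ∈ C.horizontal u ∧ rho u x = v := by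
  let Φ : (E × E) →ₗ[ℝ] (E × E) :=
    ((rho u : TangentSpace 𝓘(ℝ, E).tangent u →L[ℝ] PiBundle E M u).toLinearMap).prod
      ((C.D eta u).toLinearMap)
  have hinj : Function.Injective Φ := by
    rw [← LinearMap.ker_eq_bot, LinearMap.ker_eq_bot']
    intro x hx
    exact h.eq_zero hu (congrArg Prod.fst hx) (congrArg Prod.snd hx)
  obtain ⟨x, hx⟩ := (LinearMap.injective_iff_surjective.1 hinj) (v, 0)
  exact ⟨x, congrArg Prod.snd hx, congrArg Prod.fst hx⟩

variable {C} in
theorem IsRegular.beta_spec (h : C.IsRegular) (hu : u ∈ slit E M) (v : PiBundle E M u) :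
    C.D eta u (C.beta u v) = 0 ∧ rho u (C.beta u v) = v :=
  Classical.epsilon_spec (h.exists_horizontal hu v)

variable {C} in
theorem IsRegular.beta_rho (h : C.IsRegular) (hu : u ∈ slit E M)
    {x : TangentSpace 𝓘(ℝ, E).tangent u} (hx : C.D eta u x = 0) : C.beta u (rho u x) = x := by
  obtain ⟨h1, h2⟩ := h.beta_spec hu (rho u x)
  refine sub_eq_zero.1 (h.eq_zero hu ?_ ?_)
  · rw [map_sub, h2, sub_self]
  · rw [map_sub, h1, hx, sub_self]

variable {C} in
theorem IsRegular.beta_add (h : C.IsRegular) (hu : u ∈ slit E M) (v w : PiBundle E M u) :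
    C.beta u (v + w) = C.beta u v + C.beta u w := by
  have hv := h.beta_spec hu v
  have hw := h.beta_spec hu w
  have := h.beta_rho hu (x := C.beta u v + C.beta u w) (by rw [map_add, hv.1, hw.1, add_zero])
  rwa [map_add, hv.2, hw.2] at this

variable {C} in
theorem IsRegular.beta_smul (h : C.IsRegular) (hu : u ∈ slit E M) (c : ℝ) (v : PiBundle E M u) :
    C.beta u (c • v) = c • C.beta u v := by
  have hv := h.beta_spec hu v
  have := h.beta_rho hu (x := c • C.beta u v) (by rw [map_smul, hv.1, smul_zero])
  rwa [map_smul, hv.2] at this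

variable {C} in
-- The lift of `σ` is the preimage of `(σ, 0)` under `(ρ, D η)`. In trivializations this is a smooth
-- family of invertible operators, and operator inversion is smooth.
theorem IsRegular.fieldGerm_hlift (h : C.IsRegular) (hu : u ∈ slit E M) (hσ : PiGerm σ u) :
    FieldGerm (C.hlift σ) u := by
  filter_upwards [eventually_slit hu, hσ.eventually] with u hu hσ
  let e := trivializationAt (E × E) (TangentSpace 𝓘(ℝ, E).tangent : TM E M → Type _) u
  let p := trivializationAt E (PiBundle E M) u
  have hue : u ∈ e.baseSet := FiberBundle.mem_baseSet_trivializationAt _ _ u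
  have hup : u ∈ p.baseSet := FiberBundle.mem_baseSet_trivializationAt _ _ u
  have he : ∀ᶠ v in 𝓝 u, v ∈ e.baseSet := e.open_baseSet.mem_nhds hue
  have hp : ∀ᶠ v in 𝓝 u, v ∈ p.baseSet := p.open_baseSet.mem_nhds hup
  let A : TM E M → (E × E) →L[ℝ] (E × E) := fun v =>
    (((p.continuousLinearMapAt ℝ v).comp (rho v)).comp (e.symmL ℝ v)).prod
      (((p.continuousLinearMapAt ℝ v).comp (C.D eta v)).comp (e.symmL ℝ v))
  have hAapply : ∀ v, v ∈ e.baseSet → ∀ w, A v w = (p.continuousLinearMapAt ℝ v (rho v (e.symm v w)),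
      p.continuousLinearMapAt ℝ v (C.D eta v (e.symm v w))) := by
    intro v hv w
    simp only [A, ContinuousLinearMap.prod_apply, ContinuousLinearMap.comp_apply,
      e.symmL_apply (R := ℝ) hv]
  -- Smoothness of `A` is checked on each `w`, that is, by applying `ρ` and `D η` to the field with
  -- constant coordinate `w`.
  have hfr : ∀ w : E × E, FieldGerm (fun v => e.symm v w) u := by
    intro w
    filter_upwards [he] with v hv
    refine (e.contMDiffAt_section_iff hv).2 ?_
    refine (contMDiffAt_const (c := w)).congr_of_eventuallyEq ?_
    filter_upwards [e.open_baseSet.mem_nhds hv] with v' hv'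
    rw [e.apply_mk_symm hv']
  have hcoord : ∀ {σ : ∀ u : TM E M, PiBundle E M u}, PiGerm σ u →
      ContMDiffAt 𝓘(ℝ, E).tangent 𝓘(ℝ, E) ∞ (fun v => p.continuousLinearMapAt ℝ v (σ v)) u := by
    intro σ hσ
    refine ((contMDiffAt_section u).1 hσ.contMDiffAt).congr_of_eventuallyEq ?_
    filter_upwards [hp] with v hv
    rw [p.continuousLinearMapAt_apply ℝ, p.coe_linearMapAt_of_mem hv]
  have hA : ContMDiffAt 𝓘(ℝ, E).tangent 𝓘(ℝ, (E × E) →L[ℝ] (E × E)) ∞ A u := by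
    refine contMDiffAt_clm_of_apply fun w => ?_
    refine ((hcoord (piGerm_rho (hfr w))).prodMk_space
      (hcoord (C.piGerm_D hu (hfr w) (piGerm_eta u)))).congr_of_eventuallyEq ?_
    filter_upwards [he] with v hv using hAapply v hv w
  have hequiv : ∀ v, v ∈ slit E M → v ∈ e.baseSet → v ∈ p.baseSet →
      ∃ T : (E × E) ≃L[ℝ] (E × E), (T : (E × E) →L[ℝ] (E × E)) = A v := by
    intro v hv hve hvp
    have hinj : Function.Injective (A v).toLinearMap := by
      rw [← LinearMap.ker_eq_bot, LinearMap.ker_eq_bot']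
      intro w hw
      replace hw : A v w = 0 := hw
      rw [hAapply v hve] at hw
      have h1 : p.continuousLinearEquivAt ℝ v hvp (rho v (e.symm v w)) = 0 := by
        have := congrArg Prod.fst hw
        rwa [p.coe_continuousLinearEquivAt_eq hvp]
      have h2 : p.continuousLinearEquivAt ℝ v hvp (C.D eta v (e.symm v w)) = 0 := by
        have := congrArg Prod.snd hw
        rwa [p.coe_continuousLinearEquivAt_eq hvp]
      have h3 : (e.continuousLinearEquivAt ℝ v hve).symm w = 0 :=
        h.eq_zero hv ((ContinuousLinearEquiv.map_eq_zero_iff _).1 h1)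
          ((ContinuousLinearEquiv.map_eq_zero_iff _).1 h2)
      exact (ContinuousLinearEquiv.map_eq_zero_iff _).1 h3
    exact ⟨(LinearEquiv.ofInjectiveEndo _ hinj).toContinuousLinearEquiv, by ext <;> rfl⟩
  obtain ⟨T, hT⟩ := hequiv u hu hue hup
  have : CompleteSpace E := FiniteDimensional.complete ℝ E
  have hinv : ContMDiffAt 𝓘(ℝ, E).tangent 𝓘(ℝ, (E × E) →L[ℝ] (E × E)) ∞
      (fun v => (A v).inverse) u := by
    have h1 : ContDiffAt ℝ ∞ ContinuousLinearMap.inverse (A u) := hT ▸ contDiffAt_map_inverse T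
    exact h1.contMDiffAt.comp u hA
  have hrhs := hinv.clm_apply ((hcoord hσ).prodMk_space (contMDiffAt_const (c := (0 : E))))
  rw [contMDiffAt_section]
  refine hrhs.congr_of_eventuallyEq ?_
  filter_upwards [he, hp, eventually_slit hu] with v hve hvp hv
  obtain ⟨T, hT⟩ := hequiv v hv hve hvp
  rw [← hT, ContinuousLinearMap.inverse_equiv]
  refine (ContinuousLinearEquiv.eq_symm_apply T).2 ?_
  change (T : (E × E) →L[ℝ] (E × E)) _ = _
  rw [hT]
  have hs : e.symm v (e ⟨v, C.hlift σ v⟩).2 = C.hlift σ v :=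
    (e.continuousLinearEquivAt ℝ v hve).symm_apply_apply _
  obtain ⟨h1, h2⟩ := h.beta_spec hv (σ v)
  change A v (e ⟨v, C.hlift σ v⟩).2 = _
  rw [hAapply v hve]
  rw [hs, hlift, h1, h2, map_zero]

end PiConnection
end Finsler

/-! ### Smoothness and symmetry of the Finsler metric -/

namespace Finsler

variable {E : Type*} [NormedAddCommGroup E] [NormedSpace ℝ E]
  {M : Type*} [TopologicalSpace M] [ChartedSpace E M] [IsManifold 𝓘(ℝ, E) ∞ M]
  {u v : TM E M} {L : TM E M → ℝ}

/-- The square of `L` in the chart of `TM` around `u`. -/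
def chartSq (L : TM E M → ℝ) (u : TM E M) (p y : E) : ℝ :=
  L ((extChartAt 𝓘(ℝ, E).tangent u).symm (p, y)) ^ 2

theorem extChartAt_tangent_apply (u v : TM E M) :
    extChartAt 𝓘(ℝ, E).tangent u v = (extChartAt 𝓘(ℝ, E) u.proj v.proj,
      (trivializationAt E (TangentSpace 𝓘(ℝ, E)) u.proj v).2) := by
  rw [FiberBundle.extChartAt]
  simp only [PartialEquiv.coe_trans, PartialEquiv.prod_coe, Function.comp_apply,
    PartialEquiv.refl_coe, id]
  congr 2

theorem mem_extChartAt_tangent_source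
    (hv : v.proj ∈ (trivializationAt E (TangentSpace 𝓘(ℝ, E)) u.proj).baseSet) :
    v ∈ (extChartAt 𝓘(ℝ, E).tangent u).source := by
  rw [extChartAt_source, TangentBundle.mem_chart_source_iff]
  exact hv

theorem IsFinsler.contDiffAt_chartSq (hL : IsFinsler L) (hv : v ∈ slit E M)
    (hvu : v.proj ∈ (trivializationAt E (TangentSpace 𝓘(ℝ, E)) u.proj).baseSet) :
    ContDiffAt ℝ ∞ (fun q : E × E => chartSq L u q.1 q.2) (extChartAt 𝓘(ℝ, E).tangent u v) := by
  replace hvu := mem_extChartAt_tangent_source hvu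
  have h1 : ContMDiffAt 𝓘(ℝ, E × E) 𝓘(ℝ, E).tangent ∞ (extChartAt 𝓘(ℝ, E).tangent u).symm
      (extChartAt 𝓘(ℝ, E).tangent u v) :=
    (contMDiffOn_extChartAt_symm u).contMDiffAt
      ((isOpen_extChartAt_target u).mem_nhds ((extChartAt 𝓘(ℝ, E).tangent u).map_source hvu))
  have h2 : ContMDiffAt 𝓘(ℝ, E).tangent 𝓘(ℝ, ℝ) ∞ L
      ((extChartAt 𝓘(ℝ, E).tangent u).symm (extChartAt 𝓘(ℝ, E).tangent u v)) := by
    rw [(extChartAt 𝓘(ℝ, E).tangent u).left_inv hvu]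
    exact hL.smooth.contMDiffAt ((isOpen_slit E M).mem_nhds hv)
  exact (h2.comp _ h1).contDiffAt.pow 2

theorem sq_fiberIncl_eq (hv : v.proj ∈ (trivializationAt E (TangentSpace 𝓘(ℝ, E)) u.proj).baseSet)
    (L : TM E M → ℝ) :
    (fun y : E => L (fiberIncl v.proj y) ^ 2) =
      chartSq L u (extChartAt 𝓘(ℝ, E) u.proj v.proj) ∘
        ((trivializationAt E (TangentSpace 𝓘(ℝ, E)) u.proj).continuousLinearEquivAt ℝ v.proj hv :
          E ≃L[ℝ] E) := by
  funext y
  have h : (fiberIncl v.proj y : TM E M).proj ∈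
      (trivializationAt E (TangentSpace 𝓘(ℝ, E)) u.proj).baseSet := hv
  have h2 := (extChartAt 𝓘(ℝ, E).tangent u).left_inv (mem_extChartAt_tangent_source h)
  rw [extChartAt_tangent_apply] at h2
  rw [← h2]
  rfl

/-- The metric is defined with the identification of each tangent space with `E`, which need not
vary smoothly with the base point. Passing to a fixed chart is a linear change of fibre variable, so
the Hessian transforms by the chain rule without second-order terms. -/
theorem IsFinsler.metric_eq_chart (hL : IsFinsler L) (hv : v ∈ slit E M)
    (hvu : v.proj ∈ (trivializationAt E (TangentSpace 𝓘(ℝ, E)) u.proj).baseSet)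
    (a b : PiBundle E M v) :
    metric L v a b = (1 / 2) * fderiv ℝ (fderiv ℝ (chartSq L u (extChartAt 𝓘(ℝ, E) u.proj v.proj)))
      (trivializationAt E (TangentSpace 𝓘(ℝ, E)) u.proj v).2
      (trivializationAt E (PiBundle E M) u ⟨v, a⟩).2
      (trivializationAt E (PiBundle E M) u ⟨v, b⟩).2 := by
  let A : E ≃L[ℝ] E :=
    (trivializationAt E (TangentSpace 𝓘(ℝ, E)) u.proj).continuousLinearEquivAt ℝ v.proj hvu
  let h : E → ℝ := chartSq L u (extChartAt 𝓘(ℝ, E) u.proj v.proj)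
  have hA : A (vec v) = (trivializationAt E (TangentSpace 𝓘(ℝ, E)) u.proj v).2 := rfl
  have hd : ContDiffAt ℝ ∞ h (A (vec v)) := by
    have h1 := hL.contDiffAt_chartSq hv hvu
    rw [extChartAt_tangent_apply, ← hA] at h1
    exact h1.comp (A (vec v)) (contDiffAt_const.prodMk contDiffAt_id)
  have hd' : DifferentiableAt ℝ (fderiv ℝ h) (A (vec v)) :=
    (hd.fderiv_right (m := ∞) (by simp)).differentiableAt (by simp)
  have h1 : fderiv ℝ (h ∘ A) =
      ((ContinuousLinearMap.compL ℝ E E ℝ).flip (A : E →L[ℝ] E) ∘ fderiv ℝ h) ∘ A := by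
    funext y
    exact A.comp_right_fderiv
  change ((1 / 2 : ℝ) • fderiv ℝ (fderiv ℝ fun y : E => L (fiberIncl v.proj y) ^ 2) (vec v) :
    E →L[ℝ] E →L[ℝ] ℝ) a b = _
  rw [sq_fiberIncl_eq hvu L]
  change ((1 / 2 : ℝ) • fderiv ℝ (fderiv ℝ (h ∘ A)) (vec v) : E →L[ℝ] E →L[ℝ] ℝ) a b = _
  rw [h1, A.comp_right_fderiv,
    (((ContinuousLinearMap.compL ℝ E E ℝ).flip (A : E →L[ℝ] E)).hasFDerivAt.comp _
      hd'.hasFDerivAt).fderiv]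
  rfl

theorem IsFinsler.fnGerm_metric (hL : IsFinsler L) (hu : u ∈ slit E M)
    {Y Z : ∀ u : TM E M, PiBundle E M u} (hY : PiGerm Y u) (hZ : PiGerm Z u) :
    FnGerm (fun v => metric L v (Y v) (Z v)) u := by
  filter_upwards [eventually_slit hu, hY.eventually, hZ.eventually] with u hu hY hZ
  let e := trivializationAt E (TangentSpace 𝓘(ℝ, E) : M → Type _) u.proj
  have hue : u.proj ∈ e.baseSet := FiberBundle.mem_baseSet_trivializationAt E _ u.proj
  have hbase : ∀ᶠ v : TM E M in 𝓝 u, v.proj ∈ e.baseSet :=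
    (proj E M).contMDiff.continuous.continuousAt.eventually (e.open_baseSet.mem_nhds hue)
  have h0 := hL.contDiffAt_chartSq hu hue
  let q₀ := extChartAt 𝓘(ℝ, E).tangent u u
  have hG : ContDiffAt ℝ ∞ (fun q : E × E => fderiv ℝ (fderiv ℝ (chartSq L u q.1)) q.2) q₀ := by
    -- A fibre derivative depending smoothly on parameters is smooth in them jointly; this is used
    -- twice, the second time with `q` itself enlarged to a parameter-point pair.
    refine ContDiffAt.fderiv (f := fun (q : E × E) y => fderiv ℝ (chartSq L u q.1) y)
      (n := ∞) ?_ contDiffAt_snd (by simp)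
    refine ContDiffAt.fderiv (f := fun (q : (E × E) × E) y => chartSq L u q.1.1 y)
      (g := fun q => q.2) (n := ∞) ?_ contDiffAt_snd (by simp)
    exact h0.comp (((q₀, q₀.2), q₀.2) : ((E × E) × E) × E)
      ((contDiffAt_fst.fst.fst).prodMk contDiffAt_snd)
  have hG' : ContMDiffAt 𝓘(ℝ, E).tangent 𝓘(ℝ, E →L[ℝ] E →L[ℝ] ℝ) ∞
      (fun v => fderiv ℝ (fderiv ℝ (chartSq L u (extChartAt 𝓘(ℝ, E).tangent u v).1))
        (extChartAt 𝓘(ℝ, E).tangent u v).2) u :=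
    hG.contMDiffAt.comp u contMDiffAt_extChartAt
  have h3 := (hG'.clm_apply ((contMDiffAt_section u).1 hY.contMDiffAt)).clm_apply
    ((contMDiffAt_section u).1 hZ.contMDiffAt)
  refine ((contMDiffAt_const (c := (1 / 2 : ℝ))).mul h3).congr_of_eventuallyEq ?_
  filter_upwards [hbase, eventually_slit hu] with v hv hv'
  rw [hL.metric_eq_chart hv' hv, Pi.mul_apply, extChartAt_tangent_apply]

/-- Second derivatives of a smooth function are symmetric. -/
theorem IsFinsler.metric_symm (hL : IsFinsler L) (hu : u ∈ slit E M) (a b : PiBundle E M u) :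
    metric L u a b = metric L u b a := by
  have hue : u.proj ∈ (trivializationAt E (TangentSpace 𝓘(ℝ, E)) u.proj).baseSet :=
    FiberBundle.mem_baseSet_trivializationAt E _ u.proj
  have h0 := hL.contDiffAt_chartSq hu hue
  rw [extChartAt_tangent_apply] at h0
  have h1 := ContDiffAt.comp (f := fun y : E => (extChartAt 𝓘(ℝ, E) u.proj u.proj, y))
    (trivializationAt E (TangentSpace 𝓘(ℝ, E)) u.proj u).2 h0
    (contDiffAt_const.prodMk contDiffAt_id)
  have h2 := h1.isSymmSndFDerivAt (by simpa using natCast_le_infty 2)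
  rw [hL.metric_eq_chart hu hue, hL.metric_eq_chart hu hue]
  congr 1
  exact h2 _ _

end Finsler

/-! ### Curvature of a connection on germs -/

namespace Finsler

variable {E : Type*} [NormedAddCommGroup E] [NormedSpace ℝ E]
  {M : Type*} [TopologicalSpace M] [ChartedSpace E M] [IsManifold 𝓘(ℝ, E) ∞ M]
  {u : TM E M} {L : TM E M → ℝ}

theorem nontrivial_of_mem_slit (hu : u ∈ slit E M) : Nontrivial (E × E) := by
  have : Nontrivial E := ⟨⟨vec u, 0, hu⟩⟩
  infer_instance

namespace PiConnection

variable {C : PiConnection E M} {W Z Z' : ∀ u : TM E M, PiBundle E M u}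
  {X X' Y V : ∀ u : TM E M, TangentSpace 𝓘(ℝ, E).tangent u} {f : TM E M → ℝ}

theorem curvature_swap (X Y : ∀ u : TM E M, TangentSpace 𝓘(ℝ, E).tangent u)
    (Z : ∀ u : TM E M, PiBundle E M u) (u : TM E M) :
    C.curvature X Y Z u = -C.curvature Y X Z u := by
  unfold curvature
  rw [mlieBracket_swap_apply, map_neg]
  abel

variable [FiniteDimensional ℝ E]

theorem piGerm_curvature (hu : u ∈ slit E M) (hX : FieldGerm X u) (hY : FieldGerm Y u)
    (hZ : PiGerm Z u) : PiGerm (C.curvature X Y Z) u :=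
  ((C.piGerm_D hu hX (C.piGerm_D hu hY hZ)).sub (C.piGerm_D hu hY (C.piGerm_D hu hX hZ))).sub
    (C.piGerm_D hu (bracket hX hY) hZ)

theorem curvature_congr (hu : u ∈ slit E M) (hX : FieldGerm X u)
    (hZ : PiGerm Z u) (h : ∀ᶠ v in 𝓝 u, X' v = X v) :
    C.curvature X' Y Z u = C.curvature X Y Z u := by
  unfold curvature
  rw [EventuallyEq.mlieBracket_vectorField_eq h (EventuallyEq.refl _ Y), h.self_of_nhds,
    C.D_congr (σ := fun v => C.D Z v (X' v)) hu (C.piGerm_D hu hX hZ)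
      (h.mono fun v hv => by rw [hv])]

theorem curvature_add_left (hu : u ∈ slit E M) (hX : FieldGerm X u) (hX' : FieldGerm X' u)
    (hZ : PiGerm Z u) :
    C.curvature (X + X') Y Z u = C.curvature X Y Z u + C.curvature X' Y Z u := by
  have : CompleteSpace E := FiniteDimensional.complete ℝ E
  have e : (fun v => C.D Z v ((X + X') v))
      = (fun v => C.D Z v (X v)) + fun v => C.D Z v (X' v) := by
    funext v; simp
  unfold curvature
  rw [mlieBracket_add_left hX.mdifferentiableAt hX'.mdifferentiableAt, e,
    C.D_add hu (C.piGerm_D hu hX hZ) (C.piGerm_D hu hX' hZ)]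
  simp only [Pi.add_apply, map_add, add_apply]
  abel

theorem curvature_smul_left (hu : u ∈ slit E M) (hf : FnGerm f u) (hX : FieldGerm X u)
    (hZ : PiGerm Z u) :
    C.curvature (f • X) Y Z u = f u • C.curvature X Y Z u := by
  have : CompleteSpace E := FiniteDimensional.complete ℝ E
  have e : (fun v => C.D Z v ((f • X) v)) = f • fun v => C.D Z v (X v) := by
    funext v; simp
  unfold curvature
  rw [mlieBracket_smul_left hf.mdifferentiableAt hX.mdifferentiableAt, e,
    C.D_smul hu hf (C.piGerm_D hu hX hZ)]
  simp only [Pi.smul_apply', map_add, map_smul, neg_smul, map_neg]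
  module

theorem curvature_add_section (hu : u ∈ slit E M) (hX : FieldGerm X u) (hY : FieldGerm Y u)
    (hZ : PiGerm Z u) (hZ' : PiGerm Z' u) :
    C.curvature X Y (Z + Z') u = C.curvature X Y Z u + C.curvature X Y Z' u := by
  have key : ∀ {X : ∀ u : TM E M, TangentSpace 𝓘(ℝ, E).tangent u}, FieldGerm X u →
      C.D (fun v => C.D (Z + Z') v (X v)) u
        = C.D (fun v => C.D Z v (X v)) u + C.D (fun v => C.D Z' v (X v)) u := by
    intro X hX
    rw [← C.D_add hu (C.piGerm_D hu hX hZ) (C.piGerm_D hu hX hZ')]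
    refine C.D_congr hu ((C.piGerm_D hu hX hZ).add (C.piGerm_D hu hX hZ')) ?_
    filter_upwards [eventually_slit hu, hZ.eventually, hZ'.eventually] with v hv h h'
    rw [C.D_add hv h h']
    rfl
  unfold curvature
  rw [key hX, key hY, C.D_add hu hZ hZ']
  simp only [add_apply]
  abel

/-- The first-order terms in `f` are symmetric in `X, Y` and cancel; the second-order ones form `XYf
- YXf`, which cancels against `[X,Y]f`. -/
theorem curvature_smul_section (hu : u ∈ slit E M) (hf : FnGerm f u) (hX : FieldGerm X u)
    (hY : FieldGerm Y u) (hZ : PiGerm Z u) :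
    C.curvature X Y (f • Z) u = f u • C.curvature X Y Z u := by
  have := nontrivial_of_mem_slit hu
  have key : ∀ {X Y : ∀ u : TM E M, TangentSpace 𝓘(ℝ, E).tangent u}, FieldGerm X u →
      FieldGerm Y u → C.D (fun v => C.D (f • Z) v (Y v)) u (X u)
        = f u • C.D (fun v => C.D Z v (Y v)) u (X u)
          + mvfderiv 𝓘(ℝ, E).tangent f u (X u) • C.D Z u (Y u)
          + (mvfderiv 𝓘(ℝ, E).tangent f u (Y u) • C.D Z u (X u)
            + mvfderiv 𝓘(ℝ, E).tangent (fun v => mvfderiv 𝓘(ℝ, E).tangent f v (Y v)) u (X u)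
              • Z u) := by
    intro X Y hX hY
    have h1 := (C.piGerm_D hu hY hZ).smul hf
    have h2 := hZ.smul (hf.deriv hY)
    have e : ∀ᶠ v in 𝓝 u, C.D (f • Z) v (Y v) = (f • (fun v => C.D Z v (Y v))
        + (fun v => mvfderiv 𝓘(ℝ, E).tangent f v (Y v)) • Z) v := by
      filter_upwards [eventually_slit hu, hf.eventually, hZ.eventually] with v hv h h'
      rw [C.D_smul hv h h']
      rfl
    rw [C.D_congr hu (h1.add h2) e, C.D_add hu h1 h2, add_apply,
      C.D_smul hu hf (C.piGerm_D hu hY hZ), C.D_smul hu (hf.deriv hY) hZ]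
  unfold curvature
  rw [key hX hY, key hY hX, C.D_smul hu hf hZ, mvfderiv_mlieBracket hf hX hY]
  module

/-! ### The h-curvature as a tensor -/

/-- `β` is linear only over the slit bundle, so the lifts of sums and multiples agree merely near
`u`; `curvature_congr` absorbs this. -/
theorem curvature_hlift_congr_left (hreg : C.IsRegular) (hu : u ∈ slit E M)
    {S T : ∀ u : TM E M, PiBundle E M u} (hS : PiGerm S u) (hT : PiGerm T u)
    (hZ : PiGerm Z u) (h : S u = T u) :
    C.curvature (C.hlift S) Y Z u = C.curvature (C.hlift T) Y Z u := by
  refine eq_of_tensorial (I := 𝓘(ℝ, E).tangent) (F := E) (V := PiBundle E M)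
    (Φ := fun S => C.curvature (C.hlift S) Y Z u) ?_ ?_ hS hT h
  · intro σ τ hσ hτ
    have h1 := hreg.fieldGerm_hlift hu hσ
    have h2 := hreg.fieldGerm_hlift hu hτ
    rw [← curvature_add_left hu h1 h2 hZ]
    refine curvature_congr hu (h1.add h2) hZ ?_
    filter_upwards [eventually_slit hu] with v hv using hreg.beta_add hv _ _
  · intro f σ hf hσ
    have h1 := hreg.fieldGerm_hlift hu hσ
    rw [← curvature_smul_left hu hf h1 hZ]
    refine curvature_congr hu (h1.smul hf) hZ ?_
    filter_upwards [eventually_slit hu] with v hv using hreg.beta_smul hv _ _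

/-- Tensoriality frees `R` from the particular extensions in its definition. This is what allows `R`
to be differentiated along sections. -/
theorem R_eq (hreg : C.IsRegular) (hu : u ∈ slit E M) {S T : ∀ u : TM E M, PiBundle E M u}
    (hS : PiGerm S u) (hT : PiGerm T u) (hZ : PiGerm Z u) :
    C.R u (S u) (T u) (Z u) = C.curvature (C.hlift S) (C.hlift T) Z u := by
  have hS' : PiGerm (FiberBundle.extend E (S u)) u := Sec.extend _
  have hT' : PiGerm (FiberBundle.extend E (T u)) u := Sec.extend _
  have hZ' : PiGerm (FiberBundle.extend E (Z u)) u := Sec.extend _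
  have h1 := hreg.fieldGerm_hlift hu hS
  have h2 := hreg.fieldGerm_hlift hu hT
  unfold R
  rw [curvature_hlift_congr_left hreg hu hS' hS hZ' (by simp), curvature_swap,
    curvature_hlift_congr_left hreg hu hT' hT hZ' (by simp), ← curvature_swap]
  exact eq_of_tensorial (I := 𝓘(ℝ, E).tangent) (F := E) (V := PiBundle E M)
    (Φ := fun Z => C.curvature (C.hlift S) (C.hlift T) Z u)
    (fun σ τ hσ hτ => curvature_add_section hu h1 h2 hσ hτ)
    (fun f σ hf hσ => curvature_smul_section hu hf h1 h2 hσ) hZ' hZ (by simp)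

theorem R_swap (u : TM E M) (x y z : PiBundle E M u) : C.R u x y z = -C.R u y x z :=
  curvature_swap _ _ _ _

theorem R_add_left (hreg : C.IsRegular) (hu : u ∈ slit E M) (x x' y z : PiBundle E M u) :
    C.R u (x + x') y z = C.R u x y z + C.R u x' y z := by
  have hx : PiGerm (FiberBundle.extend E x) u := Sec.extend _
  have hx' : PiGerm (FiberBundle.extend E x') u := Sec.extend _
  have hy : PiGerm (FiberBundle.extend E y) u := Sec.extend _
  have hz : PiGerm (FiberBundle.extend E z) u := Sec.extend _
  have h := R_eq hreg hu (hx.add hx') hy hz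
  simp only [Pi.add_apply, FiberBundle.extend_apply_self] at h
  have h1 := hreg.fieldGerm_hlift hu hx
  have h2 := hreg.fieldGerm_hlift hu hx'
  rw [h]
  unfold R
  rw [← curvature_add_left hu h1 h2 hz]
  refine curvature_congr hu (h1.add h2) hz ?_
  filter_upwards [eventually_slit hu] with v hv using hreg.beta_add hv _ _

theorem R_smul_left (hreg : C.IsRegular) (hu : u ∈ slit E M) (c : ℝ) (x y z : PiBundle E M u) :
    C.R u (c • x) y z = c • C.R u x y z := by
  have hx : PiGerm (FiberBundle.extend E x) u := Sec.extend _
  have hy : PiGerm (FiberBundle.extend E y) u := Sec.extend _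
  have hz : PiGerm (FiberBundle.extend E z) u := Sec.extend _
  have h := R_eq hreg hu (hx.smul (Fn.const c u)) hy hz
  simp only [Pi.smul_apply', FiberBundle.extend_apply_self] at h
  have h1 := hreg.fieldGerm_hlift hu hx
  rw [h]
  unfold R
  rw [← curvature_smul_left hu (Fn.const c u) h1 hz]
  refine curvature_congr hu (h1.smul (Fn.const c u)) hz ?_
  filter_upwards [eventually_slit hu] with v hv using hreg.beta_smul hv _ _

theorem R_add_right (hreg : C.IsRegular) (hu : u ∈ slit E M) (x y z z' : PiBundle E M u) :
    C.R u x y (z + z') = C.R u x y z + C.R u x y z' := by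
  have hx : PiGerm (FiberBundle.extend E x) u := Sec.extend _
  have hy : PiGerm (FiberBundle.extend E y) u := Sec.extend _
  have hz : PiGerm (FiberBundle.extend E z) u := Sec.extend _
  have hz' : PiGerm (FiberBundle.extend E z') u := Sec.extend _
  have h := R_eq hreg hu hx hy (hz.add hz')
  simp only [Pi.add_apply, FiberBundle.extend_apply_self] at h
  rw [h]
  exact curvature_add_section hu (hreg.fieldGerm_hlift hu hx) (hreg.fieldGerm_hlift hu hy) hz hz'

theorem R_smul_right (hreg : C.IsRegular) (hu : u ∈ slit E M) (c : ℝ) (x y z : PiBundle E M u) :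
    C.R u x y (c • z) = c • C.R u x y z := by
  have hx : PiGerm (FiberBundle.extend E x) u := Sec.extend _
  have hy : PiGerm (FiberBundle.extend E y) u := Sec.extend _
  have hz : PiGerm (FiberBundle.extend E z) u := Sec.extend _
  have h := R_eq hreg hu hx hy (hz.smul (Fn.const c u))
  simp only [Pi.smul_apply', FiberBundle.extend_apply_self] at h
  rw [h]
  exact curvature_smul_section hu (Fn.const c u) (hreg.fieldGerm_hlift hu hx)
    (hreg.fieldGerm_hlift hu hy) hz

end PiConnection
end Finsler

/-! ### Symmetries of the h-curvature -/

namespace Finsler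

variable {E : Type*} [NormedAddCommGroup E] [NormedSpace ℝ E]
  {M : Type*} [TopologicalSpace M] [ChartedSpace E M] [IsManifold 𝓘(ℝ, E) ∞ M]
  {u : TM E M} {L : TM E M → ℝ}

namespace PiConnection

variable {C : PiConnection E M} {S T U V W Z : ∀ u : TM E M, PiBundle E M u}
  {X Y : ∀ u : TM E M, TangentSpace 𝓘(ℝ, E).tangent u} {f : TM E M → ℝ}

theorem IsCartan.mvfderiv_metric (hC : C.IsCartan L) (hu : u ∈ slit E M) (hZ : PiGerm Z u)
    (hW : PiGerm W u) (x : TangentSpace 𝓘(ℝ, E).tangent u) :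
    mvfderiv 𝓘(ℝ, E).tangent (fun v => metric L v (Z v) (W v)) u x
      = metric L u (C.D Z u x) (W u) + metric L u (Z u) (C.D W u x) := by
  obtain ⟨s, hs, hus, h⟩ :=
    eventually_nhds_iff_exists_isOpen.1 ((hZ.and hW).and (eventually_slit hu))
  exact hC.metric_compatible s hs (fun v hv => (h v hv).2) Z W
    (fun v hv => (h v hv).1.1.contMDiffWithinAt)
    (fun v hv => (h v hv).1.2.contMDiffWithinAt) u hus x

variable [FiniteDimensional ℝ E]

/-- Differentiate `g(Z,W)` twice by metric compatibility: the mixed terms are symmetric in `X, Y`,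
and the commutator minus the `[X,Y]` derivative is zero. -/
theorem IsCartan.metric_curvature (hC : C.IsCartan L) (hL : IsFinsler L) (hu : u ∈ slit E M)
    (hX : FieldGerm X u) (hY : FieldGerm Y u) (hZ : PiGerm Z u) (hW : PiGerm W u) :
    metric L u (C.curvature X Y Z u) (W u) = -metric L u (Z u) (C.curvature X Y W u) := by
  have := nontrivial_of_mem_slit hu
  have key : ∀ {X Y : ∀ u : TM E M, TangentSpace 𝓘(ℝ, E).tangent u}, FieldGerm X u →
      FieldGerm Y u → mvfderiv 𝓘(ℝ, E).tangent (fun v => mvfderiv 𝓘(ℝ, E).tangent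
          (fun v => metric L v (Z v) (W v)) v (Y v)) u (X u)
        = metric L u (C.D (fun v => C.D Z v (Y v)) u (X u)) (W u)
          + metric L u (C.D Z u (Y u)) (C.D W u (X u))
          + (metric L u (C.D Z u (X u)) (C.D W u (Y u))
            + metric L u (Z u) (C.D (fun v => C.D W v (Y v)) u (X u))) := by
    intro X Y hX hY
    have e : (fun v => mvfderiv 𝓘(ℝ, E).tangent (fun v => metric L v (Z v) (W v)) v (Y v))
        =ᶠ[𝓝 u] (fun v => metric L v (C.D Z v (Y v)) (W v))
          + fun v => metric L v (Z v) (C.D W v (Y v)) := by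
      filter_upwards [eventually_slit hu, hZ.eventually, hW.eventually] with v hv h h'
      exact hC.mvfderiv_metric hv h h' (Y v)
    have hZ' := C.piGerm_D hu hY hZ
    have hW' := C.piGerm_D hu hY hW
    rw [mvfderiv_congr e, mvfderiv_add (hL.fnGerm_metric hu hZ' hW).mdifferentiableAt
      (hL.fnGerm_metric hu hZ hW').mdifferentiableAt, add_apply,
      hC.mvfderiv_metric hu hZ' hW, hC.mvfderiv_metric hu hZ hW']
  have h := mvfderiv_mlieBracket (hL.fnGerm_metric hu hZ hW) hX hY
  rw [key hX hY, key hY hX, hC.mvfderiv_metric hu hZ hW] at h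
  simp only [curvature, map_sub, sub_apply]
  linarith

theorem IsCartan.R4_swap_right (hC : C.IsCartan L) (hL : IsFinsler L) (hu : u ∈ slit E M)
    (x y z w : PiBundle E M u) : C.R4 L u x y z w = -C.R4 L u x y w z := by
  have hx : PiGerm (FiberBundle.extend E x) u := Sec.extend _
  have hy : PiGerm (FiberBundle.extend E y) u := Sec.extend _
  have hz : PiGerm (FiberBundle.extend E z) u := Sec.extend _
  have hw : PiGerm (FiberBundle.extend E w) u := Sec.extend _
  have h := hC.metric_curvature hL hu (hC.regular.fieldGerm_hlift hu hx)
    (hC.regular.fieldGerm_hlift hu hy) hz hw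
  rw [FiberBundle.extend_apply_self, FiberBundle.extend_apply_self,
    hL.metric_symm hu z] at h
  exact h

/-! ### Bianchi identities -/

/-- The bracket of two horizontal lifts, projected to the base. -/
def hbracket (C : PiConnection E M) (S T : ∀ u : TM E M, PiBundle E M u) (u : TM E M) :
    PiBundle E M u :=
  rho u (mlieBracket 𝓘(ℝ, E).tangent (C.hlift S) (C.hlift T) u)

theorem IsRegular.piGerm_hbracket (hreg : C.IsRegular) (hu : u ∈ slit E M) (hS : PiGerm S u)
    (hT : PiGerm T u) : PiGerm (C.hbracket S T) u :=
  piGerm_rho (bracket (hreg.fieldGerm_hlift hu hS) (hreg.fieldGerm_hlift hu hT))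

theorem IsCartan.D_sub_D_eq_hbracket (hC : C.IsCartan L) (hu : u ∈ slit E M) (hS : PiGerm S u)
    (hT : PiGerm T u) :
    C.D T u (C.hlift S u) - C.D S u (C.hlift T u) = C.hbracket S T u := by
  obtain ⟨s, hs, hus, h⟩ :=
    eventually_nhds_iff_exists_isOpen.1 ((hS.and hT).and (eventually_slit hu))
  have h1 := hC.hh_torsion s hs (fun v hv => (h v hv).2) S T
    (fun v hv => (h v hv).1.1.contMDiffWithinAt)
    (fun v hv => (h v hv).1.2.contMDiffWithinAt) u hus
  have key : ∀ {S : ∀ u : TM E M, PiBundle E M u}, PiGerm S u →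
      C.D (fun v => rho v (C.hlift S v)) u = C.D S u := fun hS =>
    C.D_congr hu hS ((eventually_slit hu).mono fun v hv => (hC.regular.beta_spec hv _).2)
  unfold torsion at h1
  rw [key hS, key hT] at h1
  exact sub_eq_zero.1 h1

/-- In `R(S,T)η` the iterated derivatives vanish since `η` is horizontally parallel, leaving
`-D_[βS,βT] η`. So the bracket is horizontal, and a horizontal vector is the lift of its projection.
-/
theorem HorizontallyIntegrable.hlift_hbracket (hint : C.HorizontallyIntegrable)
    (hreg : C.IsRegular) (hu : u ∈ slit E M) (hS : PiGerm S u) (hT : PiGerm T u) :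
    C.hlift (C.hbracket S T) u
      = mlieBracket 𝓘(ℝ, E).tangent (C.hlift S) (C.hlift T) u := by
  refine hreg.beta_rho hu ?_
  have h := R_eq hreg hu hS hT (piGerm_eta u)
  have key : ∀ {S : ∀ u : TM E M, PiBundle E M u}, PiGerm S u →
      C.D (fun v => C.D eta v (C.hlift S v)) u = 0 := by
    intro S hS
    rw [C.D_congr (σ := fun v => C.D eta v (C.hlift S v)) (τ := 0) hu
      ((piGerm_eta u).smul (Fn.const 0 u) |>.congr
      (Eventually.of_forall fun v => by simp))
      ((eventually_slit hu).mono fun v hv => (hreg.beta_spec hv _).1)]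
    exact C.isCovariantDerivativeOn.zero hu
  have h0 : C.R u (S u) (T u) (eta u) = 0 := hint u hu _ _
  rw [h0] at h
  unfold curvature at h
  rw [key hS, key hT] at h
  simpa using h.symm

theorem IsCartan.bianchi_first (hC : C.IsCartan L) (hint : C.HorizontallyIntegrable)
    (hu : u ∈ slit E M) (x y z : PiBundle E M u) :
    C.R u x y z + C.R u y z x + C.R u z x y = 0 := by
  have hreg := hC.regular
  obtain ⟨S, hS, rfl⟩ : ∃ S, PiGerm S u ∧ S u = x := ⟨_, Sec.extend x, by simp⟩
  obtain ⟨T, hT, rfl⟩ : ∃ S, PiGerm S u ∧ S u = y := ⟨_, Sec.extend y, by simp⟩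
  obtain ⟨Z, hZ, rfl⟩ : ∃ S, PiGerm S u ∧ S u = z := ⟨_, Sec.extend z, by simp⟩
  -- Vanishing torsion is applied twice, first to `T, Z` and then to `S` and the projected bracket
  -- of `βT, βZ`. The right-hand sides sum cyclically to zero by the Jacobi identity.
  have key : ∀ {S T Z : ∀ u : TM E M, PiBundle E M u}, PiGerm S u → PiGerm T u → PiGerm Z u →
      C.D (fun v => C.D Z v (C.hlift T v)) u (C.hlift S u)
        - C.D (fun v => C.D T v (C.hlift Z v)) u (C.hlift S u)
        - C.D S u (mlieBracket 𝓘(ℝ, E).tangent (C.hlift T) (C.hlift Z) u)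
      = rho u (mlieBracket 𝓘(ℝ, E).tangent (C.hlift S)
          (mlieBracket 𝓘(ℝ, E).tangent (C.hlift T) (C.hlift Z)) u) := by
    intro S T Z hS hT hZ
    have h1 := C.piGerm_D hu (hreg.fieldGerm_hlift hu hT) hZ
    have h2 := C.piGerm_D hu (hreg.fieldGerm_hlift hu hZ) hT
    have hN := hreg.piGerm_hbracket hu hT hZ
    rw [← sub_apply, ← C.D_sub hu h1 h2, ← hint.hlift_hbracket hreg hu hT hZ,
      C.D_congr (τ := C.hbracket T Z) hu hN, hC.D_sub_D_eq_hbracket hu hS hN]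
    · unfold hbracket
      rw [EventuallyEq.mlieBracket_vectorField_eq (EventuallyEq.refl _ (C.hlift S))]
      filter_upwards [eventually_slit hu, hT.eventually, hZ.eventually] with v hv hT hZ
      exact hint.hlift_hbracket hreg hv hT hZ
    · filter_upwards [eventually_slit hu, hT.eventually, hZ.eventually] with v hv hT hZ
      exact hC.D_sub_D_eq_hbracket hv hT hZ
  have h1 := key hS hT hZ
  have h2 := key hT hZ hS
  have h3 := key hZ hS hT
  have hj := congrArg (rho u) (jacobi_cyclic (hreg.fieldGerm_hlift hu hS)
    (hreg.fieldGerm_hlift hu hT) (hreg.fieldGerm_hlift hu hZ))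
  rw [map_add, map_add, map_zero] at hj
  rw [R_eq hreg hu hS hT hZ, R_eq hreg hu hT hZ hS, R_eq hreg hu hZ hS hT]
  unfold curvature
  linear_combination (norm := module) h1 + h2 + h3 + hj

/-- Valid for arbitrary fields on `TM`: the triple derivatives and the derivatives along brackets
cancel in pairs, and the double brackets cancel by the Jacobi identity. -/
theorem bianchi_second (hu : u ∈ slit E M) {X₁ X₂ X₃ : ∀ u : TM E M, TangentSpace 𝓘(ℝ, E).tangent u}
    (h₁ : FieldGerm X₁ u) (h₂ : FieldGerm X₂ u) (h₃ : FieldGerm X₃ u) (hZ : PiGerm Z u) :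
    C.D (C.curvature X₂ X₃ Z) u (X₁ u) - C.curvature X₂ X₃ (fun v => C.D Z v (X₁ v)) u
      - C.curvature (mlieBracket 𝓘(ℝ, E).tangent X₁ X₂) X₃ Z u
    + (C.D (C.curvature X₃ X₁ Z) u (X₂ u) - C.curvature X₃ X₁ (fun v => C.D Z v (X₂ v)) u
      - C.curvature (mlieBracket 𝓘(ℝ, E).tangent X₂ X₃) X₁ Z u)
    + (C.D (C.curvature X₁ X₂ Z) u (X₃ u) - C.curvature X₁ X₂ (fun v => C.D Z v (X₃ v)) u
      - C.curvature (mlieBracket 𝓘(ℝ, E).tangent X₃ X₁) X₂ Z u) = 0 := by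
  have key : ∀ {X Y V : ∀ u : TM E M, TangentSpace 𝓘(ℝ, E).tangent u}, FieldGerm X u →
      FieldGerm Y u → FieldGerm V u → C.D (C.curvature X Y Z) u (V u) =
        C.D (fun v => C.D (fun v => C.D Z v (Y v)) v (X v)) u (V u)
          - C.D (fun v => C.D (fun v => C.D Z v (X v)) v (Y v)) u (V u)
          - C.D (fun v => C.D Z v (mlieBracket 𝓘(ℝ, E).tangent X Y v)) u (V u) := by
    intro X Y V hX hY hV
    have h1 := C.piGerm_D hu hX (C.piGerm_D hu hY hZ)
    have h2 := C.piGerm_D hu hY (C.piGerm_D hu hX hZ)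
    have h3 := C.piGerm_D hu (bracket hX hY) hZ
    rw [← sub_apply, ← sub_apply, ← C.D_sub hu h1 h2, ← C.D_sub hu (h1.sub h2) h3]
    rfl
  have hj := congrArg (C.D Z u) (jacobi_cyclic h₁ h₂ h₃)
  rw [map_add, map_add, map_zero] at hj
  rw [key h₁ h₂ h₃, key h₂ h₃ h₁, key h₃ h₁ h₂]
  unfold curvature
  rw [mlieBracket_swap_apply (V := mlieBracket _ X₂ X₃) (W := X₁),
    mlieBracket_swap_apply (V := mlieBracket _ X₃ X₁) (W := X₂),
    mlieBracket_swap_apply (V := mlieBracket _ X₁ X₂) (W := X₃), map_neg, map_neg, map_neg]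
  linear_combination (norm := module) -hj

/-- Metric compatibility moves the derivative inside `g`, and the term differentiating `W` cancels.
-/
theorem IsCartan.hDeriv_R4 (hC : C.IsCartan L) (hu : u ∈ slit E M)
    (hU : PiGerm U u) (hS : PiGerm S u) (hT : PiGerm T u) (hZ : PiGerm Z u) (hW : PiGerm W u) :
    C.hDeriv (C.R4 L) U S T Z W u = metric L u
      (C.D (C.curvature (C.hlift S) (C.hlift T) Z) u (C.hlift U u)
        - C.R u (C.D S u (C.hlift U u)) (T u) (Z u) - C.R u (S u) (C.D T u (C.hlift U u)) (Z u)
        - C.curvature (C.hlift S) (C.hlift T) (fun v => C.D Z v (C.hlift U v)) u) (W u) := by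
  have hreg := hC.regular
  have h1 := hreg.fieldGerm_hlift hu hS
  have h2 := hreg.fieldGerm_hlift hu hT
  have hK := piGerm_curvature (C := C) hu h1 h2 hZ
  have hDZ := C.piGerm_D hu (hreg.fieldGerm_hlift hu hU) hZ
  have e : (fun v => C.R4 L v (S v) (T v) (Z v) (W v))
      =ᶠ[𝓝 u] fun v => metric L v (C.curvature (C.hlift S) (C.hlift T) Z v) (W v) := by
    filter_upwards [eventually_slit hu, hS.eventually, hT.eventually, hZ.eventually]
      with v hv hS hT hZ
    rw [R4, R_eq hreg hv hS hT hZ]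
  unfold hDeriv
  rw [mvfderiv_congr e, hC.mvfderiv_metric hu hK hW, ← R_eq hreg hu hS hT hDZ]
  simp only [R4, map_sub, sub_apply, R_eq hreg hu hS hT hZ]
  ring

/-- Brackets of lifts are lifts of `D_S T - D_T S`, so the bracket terms in `bianchi_second` become
the correction terms of the tensor derivative. -/
theorem IsCartan.hDeriv_R4_cyclic (hC : C.IsCartan L)
    (hint : C.HorizontallyIntegrable) (hu : u ∈ slit E M)
    (hU : PiGerm U u) (hS : PiGerm S u) (hT : PiGerm T u) (hZ : PiGerm Z u) (hW : PiGerm W u) :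
    C.hDeriv (C.R4 L) U S T Z W u + C.hDeriv (C.R4 L) S T U Z W u
      + C.hDeriv (C.R4 L) T U S Z W u = 0 := by
  have hreg := hC.regular
  have h1 := hreg.fieldGerm_hlift hu hU
  have h2 := hreg.fieldGerm_hlift hu hS
  have h3 := hreg.fieldGerm_hlift hu hT
  have hb := bianchi_second (C := C) hu h1 h2 h3 hZ
  have key : ∀ {S T U : ∀ u : TM E M, PiBundle E M u}, PiGerm S u → PiGerm T u → PiGerm U u →
      C.curvature (mlieBracket 𝓘(ℝ, E).tangent (C.hlift S) (C.hlift T)) (C.hlift U) Z u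
        = C.R u (C.D T u (C.hlift S u)) (U u) (Z u)
          - C.R u (C.D S u (C.hlift T u)) (U u) (Z u) := by
    intro S T U hS hT hU
    have hN := hreg.piGerm_hbracket hu hS hT
    have h := R_eq hreg hu hN hU hZ
    rw [curvature_congr hu (hreg.fieldGerm_hlift hu hN) hZ (X' := mlieBracket 𝓘(ℝ, E).tangent
      (C.hlift S) (C.hlift T)), ← h, ← hC.D_sub_D_eq_hbracket hu hS hT, sub_eq_add_neg,
      R_add_left hreg hu, ← neg_one_smul ℝ, R_smul_left hreg hu, neg_one_smul, ← sub_eq_add_neg]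
    filter_upwards [eventually_slit hu, hS.eventually, hT.eventually] with v hv hS hT
    exact (hint.hlift_hbracket hreg hv hS hT).symm
  rw [key hU hS hT, key hS hT hU, key hT hU hS] at hb
  rw [hC.hDeriv_R4 hu hU hS hT hZ hW, hC.hDeriv_R4 hu hS hT hU hZ hW,
    hC.hDeriv_R4 hu hT hU hS hZ hW, ← add_apply, ← add_apply, ← map_add, ← map_add,
    R_swap u (S u) (C.D T u (C.hlift U u)), R_swap u (T u) (C.D U u (C.hlift S u)),
    R_swap u (U u) (C.D S u (C.hlift T u))]
  have hz : (0 : PiBundle E M u →L[ℝ] ℝ) (W u) = 0 := rfl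
  rw [← hz, ← map_zero (metric L u), ← hb]
  congr 2
  abel

end PiConnection
end Finsler

/-! ### Algebra of curvature tensors with a second Bianchi identity -/

section Algebra

variable {V : Type*} [AddCommGroup V] [Module ℝ V]

theorem exists_forall_apply_eq [FiniteDimensional ℝ V] (g : V →ₗ[ℝ] V →ₗ[ℝ] ℝ)
    (hpos : ∀ v, v ≠ 0 → 0 < g v v) (a : V →ₗ[ℝ] ℝ) : ∃ v, ∀ w, g v w = a w := by
  have hinj : Function.Injective g := by
    rw [← LinearMap.ker_eq_bot, LinearMap.ker_eq_bot']
    intro v hv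
    by_contra h
    have := hpos v h
    rw [hv] at this
    exact lt_irrefl _ this
  have hsurj := (LinearMap.injective_iff_surjective_of_finrank_eq_finrank
    (Subspace.dual_finrank_eq (K := ℝ) (V := V)).symm).1 hinj
  obtain ⟨v, hv⟩ := hsurj a
  exact ⟨v, fun w => by rw [hv]⟩

/-- Pair symmetry of algebraic curvature tensors. -/
theorem pair_symm_of_bianchi {K : V → V → V → V → ℝ} (h1 : ∀ x y z w, K x y z w = -K y x z w)
    (h2 : ∀ x y z w, K x y z w = -K x y w z)
    (hb : ∀ x y z w, K x y z w + K y z x w + K z x y w = 0) (x y z w : V) :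
    K x y z w = K z w x y := by
  -- The octahedron argument: a signed combination of the four Bianchi identities leaves, after the
  -- skew symmetries, twice the difference of the two sides.
  linarith [hb x y z w, hb y z w x, hb z w x y, hb w x y z, h1 x y z w, h1 y z w x, h1 z w x y,
    h1 w x y z, h2 x y z w, h2 y z w x, h2 z w x y, h2 w x y z, h1 z x y w, h2 z x y w,
    h1 w y z x, h2 w y z x, h1 x z w y, h2 x z w y, h1 y w x z, h2 y w x z,
    h2 y z x w, h2 z w y x, h2 w x z y, h2 x y w z, h1 x z y w, h1 y w z x]

theorem recurrence_form_relations [FiniteDimensional ℝ V] {ι : Type*} [Fintype ι]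
    (b : Module.Basis ι ℝ V) (g : V →ₗ[ℝ] V →ₗ[ℝ] ℝ) (hsymm : ∀ v w, g v w = g w v)
    (hpos : ∀ v, v ≠ 0 → 0 < g v v) {R : V → V → V → V}
    (hswap : ∀ x y z, R x y z = -R y x z)
    (hskew : ∀ x y z w, g (R x y z) w = -g (R x y w) z)
    (hbianchi : ∀ x y z, R x y z + R y z x + R z x y = 0)
    {η : V} (hη : η ≠ 0) (hRη : ∀ x y, R x y η = 0)
    {Ric : V → V → ℝ} (hRic : ∀ x z, Ric x z = ∑ i, b.coord i (R x (b i) z))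
    {Rico : V → V} (hRico : ∀ x w, g (Rico x) w = Ric x w)
    (hr : ∑ i, b.coord i (Rico (b i)) = 0) (A B : V →ₗ[ℝ] ℝ) {ρ : V} (hρ : ∀ w, g ρ w = B w)
    {G : V → V → V → V → ℝ} (hG : ∀ x y z w, G x y z w = g x z * Ric y w + g y w * Ric x z
      - g x w * Ric y z - g y z * Ric x w)
    (hrecη : ∀ t x y w, A t * g (R x y η) w + B t * G x y η w = 0)
    (hcyc : ∀ t x y z w, A t * g (R x y z) w + B t * G x y z w
      + (A x * g (R y t z) w + B x * G y t z w) + (A y * g (R t x z) w + B y * G t x z w) = 0) :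
    (∀ x, A (Rico x) = 0) ∧ (∀ x, B (Rico x) = 0) ∧ (∀ x y, A (R x y ρ) = 0) ∧
    ∀ x y z w, A x * B (R y z w) + A y * B (R z x w) + A z * B (R x y w) = 0 := by
  have hpair := pair_symm_of_bianchi (K := fun x y z w => g (R x y z) w)
    (fun x y z w => by rw [hswap x y z, map_neg]; rfl) hskew
    (fun x y z w => by
      rw [← LinearMap.add_apply, ← LinearMap.add_apply, ← map_add, ← map_add, hbianchi]; simp)
  have hη' : ∀ y z, R η y z = 0 := by
    intro y z
    by_contra h
    -- Pair symmetry equates the squared length of `R η y z` with a term containing `R(·,·)η = 0`.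
    have h1 := hpair η y z (R η y z)
    simp only [hRη, map_zero, LinearMap.zero_apply] at h1
    have h2 := hpos _ h
    have h3 := hskew z (R η y z) η y
    simp only [hRη, map_zero, LinearMap.zero_apply] at h3
    linarith
  have hRic_right : ∀ x, Ric x η = 0 := fun x => by simp [hRic, hRη]
  have hRic_left : ∀ z, Ric η z = 0 := fun z => by simp [hRic, hη']
  have hBRic : ∀ t x z, B t * Ric x z = 0 := by
    intro t x z
    -- With `η` in the first and third slots, only `g(η,η) Ric(x,z)` survives in `g ∧ Ric`.
    have h := hrecη t η x z
    rw [hG, hRη, hRic_right, hRic_left, hRic_right, map_zero, LinearMap.zero_apply] at h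
    have h2 := (hpos η hη).ne'
    have h3 : g η η * (B t * Ric x z) = 0 := by linarith
    exact (mul_eq_zero.1 h3).resolve_left h2
  have hBG : ∀ t x y z w, B t * G x y z w = 0 := by
    intro t x y z w
    rw [hG]
    linear_combination g x z * hBRic t y w + g y w * hBRic t x z - g x w * hBRic t y z
      - g y z * hBRic t x w
  have hcyc' : ∀ t x y z w, A t * g (R x y z) w + A x * g (R y t z) w + A y * g (R t x z) w = 0 := by
    intro t x y z w
    linarith [hcyc t x y z w, hBG t x y z w, hBG x y t z w, hBG y t x z w]
  have hRicρ : ∀ x, Ric x ρ = 0 := by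
    intro x
    -- At a single point `B` may vanish although it is not identically zero; then `ρ = 0` there.
    by_cases hB : B = 0
    · have : ρ = 0 := by
        by_contra h
        have := hpos ρ h
        rw [hρ, hB] at this
        exact lt_irrefl _ this
      rw [← hRico, this, map_zero]
    · obtain ⟨t, ht⟩ : ∃ t, B t ≠ 0 := by
        by_contra! h
        exact hB (LinearMap.ext h)
      exact (mul_eq_zero.1 (hBRic t x ρ)).resolve_left ht
  -- `d` is the `g`-dual basis of `b`, so traces become sums of `g(·, d i)`.
  choose d hd using fun i => exists_forall_apply_eq g hpos (b.coord i)
  have hRic' : ∀ x z, Ric x z = ∑ i, g (R x (b i) z) (d i) := fun x z => by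
    rw [hRic]
    exact Finset.sum_congr rfl fun i _ => by rw [hsymm, hd]
  have hsum : ∀ (F : V →ₗ[ℝ] ℝ) v, ∑ i, F (b i) * g v (d i) = F v := by
    intro F v
    conv_rhs => rw [← b.sum_repr v, map_sum]
    refine Finset.sum_congr rfl fun i _ => ?_
    rw [hsymm, hd, map_smul, smul_eq_mul, mul_comm]
    rfl
  have hcontr : ∀ t x z, A t * Ric x z - A x * Ric t z + A (R t x z) = 0 := by
    intro t x z
    -- Contract the cyclic identity over its third and fifth arguments.
    have h : ∑ i, (A t * g (R x (b i) z) (d i) + A x * g (R (b i) t z) (d i)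
        + A (b i) * g (R t x z) (d i)) = 0 := Finset.sum_eq_zero fun i _ => hcyc' _ _ _ _ _
    rw [Finset.sum_add_distrib, Finset.sum_add_distrib, ← Finset.mul_sum, ← Finset.mul_sum,
      hsum, ← hRic'] at h
    have h2 : ∑ i, g (R (b i) t z) (d i) = -Ric t z := by
      rw [hRic', ← Finset.sum_neg_distrib]
      refine Finset.sum_congr rfl fun i _ => ?_
      rw [hswap, map_neg]
      rfl
    rw [h2] at h
    linarith
  refine ⟨fun t => ?_, fun x => ?_, fun x y => ?_, fun x y z w => ?_⟩
  · obtain ⟨a, ha⟩ := exists_forall_apply_eq g hpos A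
    -- A second contraction, over `x` and `z`: the first term is `r A(t) = 0` and the other two are
    -- each `-A(Rico t)`.
    have h : ∑ i, (A t * Ric (b i) (d i) - A (b i) * Ric t (d i) + A (R t (b i) (d i))) = 0 :=
      Finset.sum_eq_zero fun i _ => hcontr _ _ _
    have h1 : ∑ i, Ric (b i) (d i) = 0 := by
      rw [← hr]
      exact Finset.sum_congr rfl fun i _ => by rw [← hRico, hsymm, hd]
    have h2 : ∑ i, A (b i) * Ric t (d i) = A (Rico t) := by
      rw [← hsum A (Rico t)]
      exact Finset.sum_congr rfl fun i _ => by rw [hRico]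
    have h3 : ∑ i, A (R t (b i) (d i)) = -A (Rico t) := by
      rw [← ha (Rico t), hsymm, hRico, hRic', ← Finset.sum_neg_distrib]
      exact Finset.sum_congr rfl fun i _ => by rw [← ha, hsymm, hskew]
    rw [Finset.sum_add_distrib, Finset.sum_sub_distrib, ← Finset.mul_sum, h1, h2, h3] at h
    linarith
  · rw [← hρ, hsymm, hRico, hRicρ]
  · have := hcontr x y ρ
    rw [hRicρ, hRicρ] at this
    linarith
  · have := hcyc' x y z w ρ
    simpa only [hsymm _ ρ, hρ] using this

end Algebra

/-! ### The recurrence relation on a single fibre -/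

namespace Finsler

variable {E : Type*} [NormedAddCommGroup E] [NormedSpace ℝ E] [FiniteDimensional ℝ E]
  {M : Type*} [TopologicalSpace M] [ChartedSpace E M] [IsManifold 𝓘(ℝ, E) ∞ M]
  {u : TM E M} {L : TM E M → ℝ}

/-- The Finsler metric at `u` as a bilinear form on the model space. -/
def metricForm (L : TM E M → ℝ) (u : TM E M) : E →ₗ[ℝ] E →ₗ[ℝ] ℝ :=
  let g : E →L[ℝ] E →L[ℝ] ℝ := metric L u
  (ContinuousLinearMap.coeLM ℝ).comp g.toLinearMap

theorem IsFinsler.sharp_spec (hL : IsFinsler L) (hu : u ∈ slit E M) (a : E →ₗ[ℝ] ℝ)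
    (w : PiBundle E M u) : metric L u (sharp L u a) w = a w :=
  Classical.epsilon_spec (exists_forall_apply_eq (metricForm L u) (hL.metric_pos u hu) a) w

namespace PiConnection

variable {C : PiConnection E M}

theorem R_zero_right (hreg : C.IsRegular) (hu : u ∈ slit E M) (x y : PiBundle E M u) :
    C.R u x y 0 = 0 := by
  simpa using R_smul_right hreg hu 0 x y 0

/-- `R(·,·)η` vanishes on the whole slit bundle, so its derivative does too, and the correction for
the third slot vanishes because `D η` kills horizontal vectors. -/
theorem IsCartan.hDeriv_R4_eta (hC : C.IsCartan L)
    (hint : C.HorizontallyIntegrable) (hu : u ∈ slit E M)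
    {U S T W : ∀ u : TM E M, PiBundle E M u} (hU : PiGerm U u) (hS : PiGerm S u)
    (hT : PiGerm T u) (hW : PiGerm W u) :
    C.hDeriv (C.R4 L) U S T eta W u = 0 := by
  have hreg := hC.regular
  have hR : ∀ v ∈ slit E M, ∀ x y, C.R v x y (eta v) = 0 := hint
  have hD := C.piGerm_D hu (hreg.fieldGerm_hlift hu hU) (piGerm_eta u)
  have h0 : C.D (C.curvature (C.hlift S) (C.hlift T) eta) u = 0 := by
    rw [C.D_congr (τ := 0) hu (((piGerm_eta u).smul (Fn.const 0 u)).congr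
      (Eventually.of_forall fun v => by simp))]
    · exact C.isCovariantDerivativeOn.zero hu
    · filter_upwards [eventually_slit hu, hS.eventually, hT.eventually] with v hv hS hT
      rw [← R_eq hreg hv hS hT (piGerm_eta v), hR v hv]
      rfl
  rw [hC.hDeriv_R4 hu hU hS hT (piGerm_eta u) hW, h0, hR u hu, hR u hu,
    ← R_eq hreg hu hS hT hD]
  have h1 : C.D eta u (C.hlift U u) = 0 := (hreg.beta_spec hu _).1
  rw [h1, R_zero_right hreg hu]
  simp

/-- The linear form `Ric(x, ·)`. -/
def IsRegular.ricForm (hreg : C.IsRegular) (hu : u ∈ slit E M) (x : PiBundle E M u) :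
    E →ₗ[ℝ] ℝ where
  toFun := C.Ric u x
  map_add' z z' := by
    simp only [Ric, ← Finset.sum_add_distrib]
    refine Finset.sum_congr rfl fun i _ => ?_
    exact (congrArg ((Module.finBasis ℝ E).coord i) (R_add_right hreg hu _ _ _ _)).trans
      (LinearMap.map_add ((Module.finBasis ℝ E).coord i) _ _)
  map_smul' c z := by
    simp only [Ric, Finset.smul_sum, RingHom.id_apply]
    refine Finset.sum_congr rfl fun i _ => ?_
    exact (congrArg ((Module.finBasis ℝ E).coord i) (R_smul_right hreg hu _ _ _ _)).trans
      (LinearMap.map_smul ((Module.finBasis ℝ E).coord i) _ _)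

end PiConnection

theorem IsHyperGeneralizedRecurrent.hDeriv_eq {C : PiConnection E M}
    {A B : ∀ u : TM E M, PiBundle E M u →L[ℝ] ℝ} (h : IsHyperGeneralizedRecurrent L C A B)
    (hu : u ∈ slit E M) {U X Y Z W : ∀ u : TM E M, PiBundle E M u} (hU : PiGerm U u)
    (hX : PiGerm X u) (hY : PiGerm Y u) (hZ : PiGerm Z u) (hW : PiGerm W u) :
    C.hDeriv (C.R4 L) U X Y Z W u = A u (U u) * C.R4 L u (X u) (Y u) (Z u) (W u)
      + B u (U u) * C.gKNRic L u (X u) (Y u) (Z u) (W u) := by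
  obtain ⟨s, hs, hus, k⟩ := eventually_nhds_iff_exists_isOpen.1
    ((eventually_slit hu).and (hU.and (hX.and (hY.and (hZ.and hW)))))
  exact h.recurrent s hs (fun v hv => (k v hv).1) U X Y Z W
    (fun v hv => (k v hv).2.1.contMDiffWithinAt)
    (fun v hv => (k v hv).2.2.1.contMDiffWithinAt)
    (fun v hv => (k v hv).2.2.2.1.contMDiffWithinAt)
    (fun v hv => (k v hv).2.2.2.2.1.contMDiffWithinAt)
    (fun v hv => (k v hv).2.2.2.2.2.contMDiffWithinAt) u hus

theorem PiConnection.IsCartan.recurrence_eta {C : PiConnection E M} (hC : C.IsCartan L)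
    (hint : C.HorizontallyIntegrable) {A B : ∀ u : TM E M, PiBundle E M u →L[ℝ] ℝ}
    (h : IsHyperGeneralizedRecurrent L C A B) (hu : u ∈ slit E M) (t x y w : PiBundle E M u) :
    A u t * C.R4 L u x y (eta u) w + B u t * C.gKNRic L u x y (eta u) w = 0 := by
  have hs : ∀ x : PiBundle E M u, PiGerm (FiberBundle.extend E x) u := fun _ => Sec.extend _
  have h1 := h.hDeriv_eq hu (hs t) (hs x) (hs y) (piGerm_eta u) (hs w)
  rw [hC.hDeriv_R4_eta hint hu (hs t) (hs x) (hs y) (hs w)] at h1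
  simpa using h1.symm

theorem PiConnection.IsCartan.recurrence_cyclic {C : PiConnection E M} (hC : C.IsCartan L)
    (hint : C.HorizontallyIntegrable) {A B : ∀ u : TM E M, PiBundle E M u →L[ℝ] ℝ}
    (h : IsHyperGeneralizedRecurrent L C A B) (hu : u ∈ slit E M) (t x y z w : PiBundle E M u) :
    A u t * C.R4 L u x y z w + B u t * C.gKNRic L u x y z w
      + (A u x * C.R4 L u y t z w + B u x * C.gKNRic L u y t z w)
      + (A u y * C.R4 L u t x z w + B u y * C.gKNRic L u t x z w) = 0 := by
  have hs : ∀ x : PiBundle E M u, PiGerm (FiberBundle.extend E x) u := fun _ => Sec.extend _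
  have h1 := hC.hDeriv_R4_cyclic hint hu (hs t) (hs x) (hs y) (hs z) (hs w)
  rw [h.hDeriv_eq hu (hs t) (hs x) (hs y) (hs z) (hs w),
    h.hDeriv_eq hu (hs x) (hs y) (hs t) (hs z) (hs w),
    h.hDeriv_eq hu (hs y) (hs t) (hs x) (hs z) (hs w)] at h1
  simpa using h1

end Finsler

end

theorem theorem2p5 {E : Type*} [NormedAddCommGroup E] [NormedSpace ℝ E] [FiniteDimensional ℝ E]
    {M : Type*} [TopologicalSpace M] [ChartedSpace E M] [IsManifold 𝓘(ℝ, E) ∞ M]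
    (hn : 3 ≤ Module.finrank ℝ E)
    (L : Finsler.TM E M → ℝ) (hL : Finsler.IsFinsler L)
    (C : Finsler.PiConnection E M) (hC : C.IsCartan L)
    (hint : C.HorizontallyIntegrable)
    (A B : ∀ u : Finsler.TM E M, Finsler.PiBundle E M u →L[ℝ] ℝ)
    (hrec : Finsler.IsHyperGeneralizedRecurrent L C A B)
    (hr : ∀ u ∈ Finsler.slit E M, C.scalar L u = 0) :
    (∀ u ∈ Finsler.slit E M, ∀ x : Finsler.PiBundle E M u, A u (C.Rico L u x) = 0) ∧
    (∀ u ∈ Finsler.slit E M, ∀ x : Finsler.PiBundle E M u, B u (C.Rico L u x) = 0) ∧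
    (∀ u ∈ Finsler.slit E M, ∀ x y : Finsler.PiBundle E M u,
      A u (C.R u x y (Finsler.sharp L u (B u))) = 0) ∧
    (∀ u ∈ Finsler.slit E M, ∀ x y z w : Finsler.PiBundle E M u,
      A u x * B u (C.R u y z w) + A u y * B u (C.R u z x w) + A u z * B u (C.R u x y w) = 0) := by
  have hreg := hC.regular
  -- Everything is now algebra on the fibre at `u`, with `η` the vector `u` itself; it is nonzero
  -- precisely because `u` lies in the slit bundle.
  have key : ∀ u ∈ Finsler.slit E M, _ := fun u hu =>
    recurrence_form_relations (Module.finBasis ℝ E) (Finsler.metricForm L u)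
      (hL.metric_symm hu) (hL.metric_pos u hu) (R := C.R u) (Finsler.PiConnection.R_swap u)
      (hC.R4_swap_right hL hu) (hC.bianchi_first hint hu) (η := Finsler.vec u) hu (hint u hu)
      (Ric := C.Ric u) (fun _ _ => rfl) (Rico := C.Rico L u)
      (fun x w => hL.sharp_spec hu (hreg.ricForm hu x) w)
      (hr u hu) (A u : E →L[ℝ] ℝ).toLinearMap (B u : E →L[ℝ] ℝ).toLinearMap
      (ρ := Finsler.sharp L u (B u)) (fun w => hL.sharp_spec hu (B u : E →L[ℝ] ℝ).toLinearMap w)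
      (G := C.gKNRic L u) (fun _ _ _ _ => rfl)
      (hC.recurrence_eta hint hrec hu) (hC.recurrence_cyclic hint hrec hu)
  exact ⟨fun u hu => (key u hu).1, fun u hu => (key u hu).2.1, fun u hu => (key u hu).2.2.1,
    fun u hu => (key u hu).2.2.2⟩
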